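/- Let $\mathcal M$ be a smooth (finite-dimensional, Hausdorff, $\sigma$-compact) manifold, all of whose components have the same dimension, with an arbitrary affine connection $\nabla$ (torsion and curvature allowed). Let $\mathcal R=C^\infty(\mathcal M)$, let $\mathcal V=\operatorname{Der}(\mathcal R)$ be the $\mathcal R$-module of vector fields with its Jacobi bracket $[\cdot,\cdot]_J$, and write $X\rhd Y=\nabla_XY$, $X\rhd f=X.f$ for $X,Y\in\mathcal V$, $f\in\mathcal R$. Let $t(a.b)=a\rhd b-b\rhd a-[a,b]_J$ be the torsion and $r(a.b)(c)=a\rhd(b\rhd c)-b\rhd(a\rhd c)-[a,b]_J\rhd c$ the curvature. Let $\mathfrak g=\operatorname{Lie}_{\mathcal R}(\mathcal V)\subset T_{\mathcal R}(\mathcal V)$ be the free $\mathcal R$-Lie algebra on $\mathcal V$, with bracket $[\cdot,\cdot]$ the commutator of the tensor algebra. A vector field $X$ acts on $T_{\mathcal R}(\mathcal V)$ by the derivation extending $f\mapsto X\rhd f$ and $Y\mapsto X\rhd Y$, and $T_{\mathcal R}(\mathcal V)$ acts on $\mathcal R$, on $\mathcal V$ and on $\mathfrak g$ by the higher-order covariant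 derivatives, $1\rhd w=w$ and $(X\cdot U)\rhd w=X\rhd(U\rhd w)-(X\rhd U)\rhd w$ for $X\in\mathcal V$. The Grossman–Larson bracket on $\mathfrak g$ is $[\![u,v]\!]=[u,v]+u\rhd v-v\rhd u$, and the curvature element of $a,b\in\mathcal V$ is $s(a.b)=[\![a,b]\!]-[a,b]_J\in\mathfrak g$. Let $\mathcal J\subset\mathfrak g$ be the kernel of the action $\rho:u\mapsto(u\rhd -)$ of $\mathfrak g$ on $\mathcal R$, and $\mathcal K\subset\mathfrak g$ the kernel of the action $\Phi:\mathfrak g\to\operatorname{End}_{\mathbb R}(\mathcal V)$, $\Phi(u)=u\rhd -$. Then: 1. $\Phi$ maps $\mathcal J$ into $\operatorname{End}_{\mathcal R}(\mathcal V)$. 2. $\mathcal K$ is an ideal of $\mathfrak g$ for the Grossman–Larson bracket. 3. $\mathcal K\subseteq\mathcal J$. If $\mathcal M$ is non-empty and of dimension at least $2$, then $\{0\}\subsetneq\mathcal K$. If the connection is not flat (that is, $r\neq0$), then $\{0\}\subsetneq\mathcal K\subsetneq\mathcal J$. 4. For all $a,b,c\in\mathcal V$, the expression $$[\![a,s(b.c)]\!]+[\![b,s(c.a)]\!]+[\![c,s(a.b)]\!]-s\big(a.t(b.c)\big)-s\big(b.t(c.a)\big)-s\big(c.t(a.b)\big)$$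 $$+s\big(a.(b\rhd c-c\rhd b)\big)+s\big(b.(c\rhd a-a\rhd c)\big)+s\big(c.(a\rhd b-b\rhd a)\big)$$ given by the differential Bianchi identity belongs to $\mathcal K$, and so does its second form $$[\![a,s(b.c)]\!]+[\![b,s(c.a)]\!]+[\![c,s(a.b)]\!]+s\big(a.[b,c]_J\big)+s\big(b.[c,a]_J\big)+s\big(c.[a,b]_J\big).$$ -/

import Mathlib

open scoped Manifold ContDiff TensorProduct DirectSum

noncomputable section

namespace PostLie

/-! ### Connections

`k` is the ground ring and `R` a commutative `k`-algebra; in the theorem `k = ℝ` and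
`R = C^∞(M)`.  Vector fields are the `k`-linear derivations of `R`. -/

/-- The `R`-module (and `k`-Lie algebra, for the Jacobi bracket `⁅X, Y⁆`) of vector fields. -/
abbrev VField (k R : Type*) [CommRing k] [CommRing R] [Algebra k R] := Derivation k R R

/-- A connection on an `R`-module `W`: `X ▷ w` is `R`-linear in the vector field `X`, `k`-linear
in `w`, and satisfies the Leibniz rule `X ▷ (f w) = (X f) w + f (X ▷ w)`. -/
structure Connection (k R W : Type*) [CommRing k] [CommRing R] [Algebra k R]
    [AddCommGroup W] [Module k W] [Module R W] [IsScalarTower k R W] where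
  cov : VField k R →ₗ[R] W →ₗ[k] W
  leibniz : ∀ (X : VField k R) (f : R) (w : W), cov X (f • w) = X f • w + f • cov X w

/-- An affine connection: a connection on the module of vector fields itself. -/
abbrev AffineConnection (k R : Type*) [CommRing k] [CommRing R] [Algebra k R] :=
  Connection k R (VField k R)

variable {k R : Type*} [CommRing k] [CommRing R] [Algebra k R]

/-- The connection `X ▷ f = X f` on functions. -/
def trivialConnection (k R : Type*) [CommRing k] [CommRing R] [Algebra k R] :
    Connection k R R where
  cov :=
    { toFun := fun X => (X : R →ₗ[k] R)
      map_add' := fun _ _ => rfl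
      map_smul' := fun _ _ => rfl }
  leibniz := fun X f w => by
    simp [mul_comm, add_comm]

/-! ### The tensor algebra of the module of vector fields, and its connection -/

/-- The tensor algebra `A = T_R(V)` over `R` of the module `V` of vector fields. -/
abbrev TAlg (k R : Type*) [CommRing k] [CommRing R] [Algebra k R] :=
  TensorAlgebra R (VField k R)

instance : LieRing (TAlg k R) := LieRing.ofAssociativeRing

instance : LieAlgebra R (TAlg k R) := LieAlgebra.ofAssociativeAlgebra

/-- Dual numbers `U + ε U'` over the tensor algebra, with the `R`-algebra structure
`f ↦ f + ε (X f)`. -/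
def Twisted (_X : VField k R) : Type _ := DualNumber (TAlg k R)

namespace Twisted

variable {X : VField k R}

instance : Ring (Twisted X) := inferInstanceAs (Ring (DualNumber (TAlg k R)))

/-- The element `U + ε U'`. -/
def mk (X : VField k R) (U U' : TAlg k R) : Twisted X :=
  (TrivSqZeroExt.inl U + TrivSqZeroExt.inr U' : DualNumber (TAlg k R))

/-- The coefficient of `1`. -/
def re (z : Twisted X) : TAlg k R := TrivSqZeroExt.fst (z : DualNumber (TAlg k R))

/-- The coefficient of `ε`. -/
def im (z : Twisted X) : TAlg k R := TrivSqZeroExt.snd (z : DualNumber (TAlg k R))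

theorem ext {z w : Twisted X} (h : z.re = w.re) (h' : z.im = w.im) : z = w :=
  TrivSqZeroExt.ext h h'

theorem re_mk (U U' : TAlg k R) : (mk X U U').re = U := by
  change U + 0 = U
  exact add_zero U

theorem im_mk (U U' : TAlg k R) : (mk X U U').im = U' := by
  change 0 + U' = U'
  exact zero_add U'

theorem re_add (z w : Twisted X) : (z + w).re = z.re + w.re := rfl

theorem im_add (z w : Twisted X) : (z + w).im = z.im + w.im := rfl

theorem re_mul (z w : Twisted X) : (z * w).re = z.re * w.re := rfl

theorem im_mul (z w : Twisted X) : (z * w).im = z.im * w.re + z.re * w.im :=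
  (TrivSqZeroExt.snd_mul _ _).trans (add_comm _ _)

theorem re_one : (1 : Twisted X).re = 1 := rfl

theorem im_one : (1 : Twisted X).im = 0 := rfl

theorem re_zero : (0 : Twisted X).re = 0 := rfl

theorem im_zero : (0 : Twisted X).im = 0 := rfl

/-- The ring morphism `f ↦ f + ε (X f)`. -/
def hom (X : VField k R) : R →+* Twisted X where
  toFun f := mk X (algebraMap R _ f) (algebraMap R _ (X f))
  map_one' := ext (by rw [re_mk, map_one, re_one]) (by
    rw [im_mk, Derivation.map_one_eq_zero, map_zero, im_one])
  map_zero' := ext (by rw [re_mk, map_zero, re_zero]) (by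
    rw [im_mk, map_zero, map_zero, im_zero])
  map_add' f g := ext (by rw [re_add, re_mk, re_mk, re_mk, map_add]) (by
    rw [im_add, im_mk, im_mk, im_mk, map_add, map_add])
  map_mul' f g := ext (by rw [re_mul, re_mk, re_mk, re_mk, map_mul]) (by
    rw [im_mul, re_mk, re_mk, im_mk, im_mk, im_mk, Derivation.leibniz, map_add, smul_eq_mul,
      smul_eq_mul, map_mul, map_mul, add_comm, Algebra.commutes g])

theorem re_hom (f : R) : (hom X f).re = algebraMap R _ f := re_mk _ _

theorem im_hom (f : R) : (hom X f).im = algebraMap R _ (X f) := im_mk _ _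

theorem hom_comm (f : R) (z : Twisted X) : hom X f * z = z * hom X f :=
  ext (by rw [re_mul, re_mul, re_hom, Algebra.commutes]) (by
    rw [im_mul, im_mul, re_hom, im_hom, add_comm, Algebra.commutes f z.im,
      Algebra.commutes (X f) z.re])

instance : Algebra R (Twisted X) := RingHom.toAlgebra' (hom X) hom_comm

theorem smul_def (f : R) (z : Twisted X) : f • z = hom X f * z := rfl

theorem algebraMap_eq (f : R) : algebraMap R (Twisted X) f = hom X f := rfl

end Twisted

open Twisted in
/-- The algebra morphism `U ↦ U + ε (X ▷ U)` extending `Y ↦ Y + ε (X ▷ Y)`. -/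
def derivHom (nabla : AffineConnection k R) (X : VField k R) : TAlg k R →ₐ[R] Twisted X :=
  TensorAlgebra.lift R
    { toFun := fun Y => mk X (TensorAlgebra.ι R Y) (TensorAlgebra.ι R (nabla.cov X Y))
      map_add' := fun Y Z => Twisted.ext (by simp only [re_add, re_mk, map_add])
        (by simp only [im_add, im_mk, map_add])
      map_smul' := fun f Y => by
        rw [RingHom.id_apply, Twisted.smul_def]
        refine Twisted.ext ?_ ?_
        · rw [re_mul, re_mk, re_mk, re_hom, map_smul, Algebra.smul_def]
        · rw [im_mul, im_mk, im_mk, re_hom, im_hom, re_mk, nabla.leibniz, map_add, map_smul,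
            map_smul, Algebra.smul_def, Algebra.smul_def] }

/-- `X ▷ U` for a vector field `X` and `U` in the tensor algebra: the derivation of the tensor
algebra that extends `Y ↦ X ▷ Y` and `f ↦ X f`. -/
def deriv (nabla : AffineConnection k R) (X : VField k R) (U : TAlg k R) : TAlg k R :=
  (derivHom nabla X U).im

section deriv

variable (nabla : AffineConnection k R) (X : VField k R)

theorem derivHom_ι (Y : VField k R) : derivHom nabla X (TensorAlgebra.ι R Y) =
    Twisted.mk X (TensorAlgebra.ι R Y) (TensorAlgebra.ι R (nabla.cov X Y)) := by
  unfold derivHom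
  rw [TensorAlgebra.lift_ι_apply]
  rfl

theorem deriv_ι (Y : VField k R) :
    deriv nabla X (TensorAlgebra.ι R Y) = TensorAlgebra.ι R (nabla.cov X Y) := by
  rw [deriv, derivHom_ι, Twisted.im_mk]

theorem deriv_algebraMap (f : R) :
    deriv nabla X (algebraMap R _ f) = algebraMap R _ (X f) := by
  rw [deriv, AlgHom.commutes, Twisted.algebraMap_eq, Twisted.im_hom]

theorem deriv_add (U V : TAlg k R) :
    deriv nabla X (U + V) = deriv nabla X U + deriv nabla X V := by
  rw [deriv, map_add, Twisted.im_add, deriv, deriv]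

theorem re_derivHom (U : TAlg k R) : (derivHom nabla X U).re = U := by
  induction U using TensorAlgebra.induction with
  | algebraMap f => rw [AlgHom.commutes, Twisted.algebraMap_eq, Twisted.re_hom]
  | ι Y => rw [derivHom_ι, Twisted.re_mk]
  | mul U V hU hV => rw [map_mul, Twisted.re_mul, hU, hV]
  | add U V hU hV => rw [map_add, Twisted.re_add, hU, hV]

theorem deriv_mul (U V : TAlg k R) :
    deriv nabla X (U * V) = deriv nabla X U * V + U * deriv nabla X V := by
  rw [deriv, map_mul, Twisted.im_mul, re_derivHom, re_derivHom, deriv, deriv]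

theorem deriv_smul (f : R) (U : TAlg k R) :
    deriv nabla X (f • U) = X f • U + f • deriv nabla X U := by
  rw [Algebra.smul_def, deriv_mul, deriv_algebraMap, Algebra.smul_def, Algebra.smul_def]

theorem deriv_smul_ground (c : k) (U : TAlg k R) :
    deriv nabla X (c • U) = c • deriv nabla X U := by
  rw [← algebraMap_smul R c U, deriv_smul, ← algebraMap_smul R c (deriv nabla X U)]
  simp

theorem deriv_add_left (X Y : VField k R) (U : TAlg k R) :
    deriv nabla (X + Y) U = deriv nabla X U + deriv nabla Y U := by
  induction U using TensorAlgebra.induction with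
  | algebraMap f => simp [deriv_algebraMap]
  | ι Z => simp [deriv_ι]
  | mul U V hU hV => simp only [deriv_mul, hU, hV, add_mul, mul_add]; abel
  | add U V hU hV => simp only [deriv_add, hU, hV]; abel

theorem deriv_smul_left (f : R) (X : VField k R) (U : TAlg k R) :
    deriv nabla (f • X) U = f • deriv nabla X U := by
  induction U using TensorAlgebra.induction with
  | algebraMap g => simp [deriv_algebraMap, Algebra.smul_def]
  | ι Z => simp [deriv_ι]
  | mul U V hU hV =>
    simp only [deriv_mul, hU, hV, smul_add, smul_mul_assoc, mul_smul_comm]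
  | add U V hU hV => simp only [deriv_add, hU, hV, smul_add]

end deriv

/-! ### The free Lie algebra `g` of the module of vector fields -/

/-- The free `R`-Lie algebra `g` on the module of vector fields, realised as the span of the
iterated commutators of vector fields in the tensor algebra. -/
abbrev FreeLie (k R : Type*) [CommRing k] [CommRing R] [Algebra k R] :
    LieSubalgebra R (TAlg k R) :=
  LieSubalgebra.lieSpan R (TAlg k R) (Set.range (TensorAlgebra.ι R (M := VField k R)))

/-- The inclusion of vector fields in `g`. -/
def inc : VField k R →ₗ[R] FreeLie k R where
  toFun X := ⟨TensorAlgebra.ι R X, LieSubalgebra.subset_lieSpan ⟨X, rfl⟩⟩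
  map_add' X Y := by ext1; simp
  map_smul' f X := by ext1; simp

theorem deriv_mem (nabla : AffineConnection k R) (X : VField k R) {U : TAlg k R}
    (hU : U ∈ FreeLie k R) : deriv nabla X U ∈ FreeLie k R := by
  induction hU using LieSubalgebra.lieSpan_induction with
  | mem U h =>
    obtain ⟨Y, rfl⟩ := h
    rw [deriv_ι]
    exact LieSubalgebra.subset_lieSpan ⟨_, rfl⟩
  | zero =>
    have h0 : deriv nabla X (0 : TAlg k R) = 0 := by
      simpa using deriv_smul_ground nabla X (0 : k) 0
    rw [h0]
    exact zero_mem _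
  | add U V hU hV h1 h2 =>
    rw [deriv_add]
    exact add_mem h1 h2
  | smul f U hU h1 =>
    rw [deriv_smul]
    exact add_mem ((FreeLie k R).smul_mem _ hU) ((FreeLie k R).smul_mem _ h1)
  | lie U V hU hV h1 h2 =>
    have h : deriv nabla X ⁅U, V⁆ = ⁅deriv nabla X U, V⁆ + ⁅U, deriv nabla X V⁆ := by
      have hs : deriv nabla X (U * V - V * U) =
          deriv nabla X (U * V) - deriv nabla X (V * U) := by
        rw [eq_sub_iff_add_eq, ← deriv_add, sub_add_cancel]
      simp only [LieRing.of_associative_ring_bracket]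
      rw [hs, deriv_mul, deriv_mul]
      abel
    rw [h]
    exact add_mem ((FreeLie k R).lie_mem h1 hV) ((FreeLie k R).lie_mem hU h2)

/-- The connection on `g` for which every vector field acts by a derivation of the bracket. -/
def freeLieConnection (nabla : AffineConnection k R) : Connection k R (FreeLie k R) where
  cov :=
    { toFun := fun X =>
        { toFun := fun u => ⟨deriv nabla X u, deriv_mem nabla X u.2⟩
          map_add' := fun u v => by ext1; simp [deriv_add]
          map_smul' := fun c u => by
            ext1
            simp [deriv_smul_ground] }
      map_add' := fun X Y => by ext u; simp [deriv_add_left]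
      map_smul' := fun f X => by ext u; simp [deriv_smul_left] }
  leibniz := fun X f u => by ext1; simp [deriv_smul]

/-! ### Higher-order covariant derivatives -/

section higher

variable {W : Type*} [AddCommGroup W] [Module k W] [Module R W] [IsScalarTower k R W]

/-- The covariant derivative of a tensor `φ` with values in `W`:
`(X ▷ φ)(v₁, …, vₙ) = X ▷ φ(v₁, …, vₙ) - ∑ᵢ φ(v₁, …, X ▷ vᵢ, …, vₙ)`. -/
def covTensor (nabla : AffineConnection k R) (D : Connection k R W) {n : ℕ}
    (X : VField k R) (φ : MultilinearMap R (fun _ : Fin n => VField k R) W) :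
    MultilinearMap R (fun _ : Fin n => VField k R) W where
  toFun v := D.cov X (φ v) - ∑ i, φ (Function.update v i (nabla.cov X (v i)))
  map_update_add' := by
    intro _ v i a b
    obtain rfl := Subsingleton.elim ‹DecidableEq (Fin n)› (instDecidableEqFin n)
    have key : ∀ c : VField k R,
        ∑ j, φ (Function.update (Function.update v i c) j
          (nabla.cov X (Function.update v i c j))) =
        φ (Function.update v i (nabla.cov X c)) + ∑ j ∈ Finset.univ.erase i,
          φ (Function.update (Function.update v j (nabla.cov X (v j))) i c) := by
      intro c
      rw [← Finset.add_sum_erase _ _ (Finset.mem_univ i)]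
      congr 1
      · simp
      · refine Finset.sum_congr rfl fun j hj => ?_
        have hji := Finset.ne_of_mem_erase hj
        rw [Function.update_of_ne hji, Function.update_comm hji]
    rw [key, key, key]
    simp only [map_add, MultilinearMap.map_update_add, Finset.sum_add_distrib]
    abel
  map_update_smul' := by
    intro _ v i f a
    obtain rfl := Subsingleton.elim ‹DecidableEq (Fin n)› (instDecidableEqFin n)
    have key : ∀ c : VField k R,
        ∑ j, φ (Function.update (Function.update v i c) j
          (nabla.cov X (Function.update v i c j))) =
        φ (Function.update v i (nabla.cov X c)) + ∑ j ∈ Finset.univ.erase i,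
          φ (Function.update (Function.update v j (nabla.cov X (v j))) i c) := by
      intro c
      rw [← Finset.add_sum_erase _ _ (Finset.mem_univ i)]
      congr 1
      · simp
      · refine Finset.sum_congr rfl fun j hj => ?_
        have hji := Finset.ne_of_mem_erase hj
        rw [Function.update_of_ne hji, Function.update_comm hji]
    rw [key, key]
    simp only [nabla.leibniz, D.leibniz, MultilinearMap.map_update_add,
      MultilinearMap.map_update_smul, smul_sub, smul_add, Finset.smul_sum]
    abel

/-- The iterated covariant derivative `∇ⁿ w`, with
`(∇ⁿ⁺¹ w)(X, v₁, …, vₙ) = (X ▷ ∇ⁿ w)(v₁, …, vₙ)`. -/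
def iterCov (nabla : AffineConnection k R) (D : Connection k R W) (w : W) :
    (n : ℕ) → MultilinearMap R (fun _ : Fin n => VField k R) W
  | 0 => MultilinearMap.constOfIsEmpty R _ w
  | n + 1 => LinearMap.uncurryLeft (M := fun _ : Fin (n + 1) => VField k R)
      { toFun := fun X => covTensor nabla D X (iterCov nabla D w n)
        map_add' := fun X Y => by
          ext v
          simp [covTensor, MultilinearMap.map_update_add, Finset.sum_add_distrib]
          abel
        map_smul' := fun f X => by
          ext v
          simp [covTensor, MultilinearMap.map_update_smul, smul_sub, Finset.smul_sum] }

theorem iterCov_add (nabla : AffineConnection k R) (D : Connection k R W) (w w' : W) (n : ℕ) :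
    iterCov nabla D (w + w') n = iterCov nabla D w n + iterCov nabla D w' n := by
  induction n with
  | zero => ext v; simp [iterCov]
  | succ n ih =>
    ext v
    simp [iterCov, covTensor, ih, Finset.sum_add_distrib]
    abel

theorem iterCov_smul (nabla : AffineConnection k R) (D : Connection k R W) (c : k) (w : W)
    (n : ℕ) (v : Fin n → VField k R) :
    iterCov nabla D (c • w) n v = c • iterCov nabla D w n v := by
  induction n with
  | zero => simp [iterCov]
  | succ n ih => simp [iterCov, covTensor, ih, smul_sub, Finset.smul_sum]

/-- The action `U ▷ w` of the tensor algebra on a module with connection: `1 ▷ w = w` and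
`(X · U) ▷ w = X ▷ (U ▷ w) - (X ▷ U) ▷ w`, that is,
`(X₁ ⋯ Xₙ) ▷ w = (∇ⁿ w)(X₁, …, Xₙ)`. -/
def act (nabla : AffineConnection k R) (D : Connection k R W) :
    TAlg k R →ₗ[R] W →ₗ[k] W where
  toFun U :=
    { toFun := fun w =>
        DirectSum.toModule R ℕ W (fun n => PiTensorProduct.lift (iterCov nabla D w n))
          (TensorAlgebra.toDirectSum U)
      map_add' := fun w w' => by
        rw [← LinearMap.add_apply]
        refine LinearMap.congr_fun (DirectSum.linearMap_ext R fun n => ?_) _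
        ext v
        simp [iterCov_add]
      map_smul' := fun c w => by
        have h : DirectSum.toModule R ℕ W
            (fun n => PiTensorProduct.lift (iterCov nabla D (c • w) n)) =
            algebraMap k R c • DirectSum.toModule R ℕ W
              (fun n => PiTensorProduct.lift (iterCov nabla D w n)) := by
          refine DirectSum.linearMap_ext R fun n => ?_
          ext v
          simp [iterCov_smul]
        rw [h]
        simp }
  map_add' U U' := by ext w; simp
  map_smul' f U := by ext w; simp

end higher

/-! ### The post-Lie product, the Grossman–Larson bracket, torsion and curvature -/

section postLie

variable (nabla : AffineConnection k R)

/-- The product `u ▷ v` on `g`. -/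
def tri (u v : FreeLie k R) : FreeLie k R := act nabla (freeLieConnection nabla) u v

/-- The Grossman–Larson bracket `⟦u, v⟧ = [u, v] + u ▷ v - v ▷ u` on `g`. -/
def glBracket (u v : FreeLie k R) : FreeLie k R := ⁅u, v⁆ + tri nabla u v - tri nabla v u

/-- The action `ρ(u) f = u ▷ f` of `g` on functions. -/
def rho : FreeLie k R →ₗ[R] R →ₗ[k] R :=
  (act nabla (trivialConnection k R)).comp (FreeLie k R).toSubmodule.subtype

/-- The action `Φ(u) a = u ▷ a` of `g` on vector fields. -/
def Phi : FreeLie k R →ₗ[R] VField k R →ₗ[k] VField k R :=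
  (act nabla nabla).comp (FreeLie k R).toSubmodule.subtype

/-- The kernel `J` of `ρ`. -/
def J : Submodule R (FreeLie k R) := LinearMap.ker (rho nabla)

/-- The kernel `K` of `Φ`. -/
def K : Submodule R (FreeLie k R) := LinearMap.ker (Phi nabla)

/-- `S` is an ideal of `g` for the Grossman–Larson bracket. -/
def IsGLIdeal (S : Submodule R (FreeLie k R)) : Prop :=
  ∀ u : FreeLie k R, ∀ v ∈ S, glBracket nabla u v ∈ S ∧ glBracket nabla v u ∈ S

/-- The torsion `t(a, b) = a ▷ b - b ▷ a - ⁅a, b⁆`. -/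
def torsion (a b : VField k R) : VField k R := nabla.cov a b - nabla.cov b a - ⁅a, b⁆

/-- The curvature `r(a, b) c = a ▷ (b ▷ c) - b ▷ (a ▷ c) - ⁅a, b⁆ ▷ c`. -/
def curvature (a b c : VField k R) : VField k R :=
  nabla.cov a (nabla.cov b c) - nabla.cov b (nabla.cov a c) - nabla.cov ⁅a, b⁆ c

/-- The curvature element `s(a.b) = ⟦a, b⟧ - ⁅a, b⁆` of `g`, with `⁅a, b⁆` the Jacobi bracket. -/
def curvElt (a b : VField k R) : FreeLie k R := glBracket nabla (inc a) (inc b) - inc ⁅a, b⁆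

end postLie

end PostLie

end

noncomputable section

namespace PostLie

variable {k R : Type*} [CommRing k] [CommRing R] [Algebra k R]

/-! ### The action of the tensor algebra on a module with connection -/

section act

variable (nabla : AffineConnection k R)
variable {W : Type*} [AddCommGroup W] [Module k W] [Module R W] [IsScalarTower k R W]
variable (D : Connection k R W)

/-! Elements of `g` are primitive: each acts on the tensor algebra by a derivation and satisfies `(u
* U) ▷ w = u ▷ (U ▷ w) - (u ▷ U) ▷ w`. Hence on every module with connection the Grossman–Larson
bracket acts as the commutator of operators (`act_glBracket`), and `u ▷ (f w) = (u ▷ f) w + f (u ▷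
w)` (`act_smul_of_mem_freeLie`). The formal statements follow. The Leibniz rule makes `Φ` linear
over functions on `J`, and the kernel of a representation is an ideal. Since `Φ(s(a.b))` is the
curvature operator, `Φ` turns the Bianchi expressions into Jacobi identities, and a nonzero
curvature puts some `s(a.b)` in `J` but not in `K`. If `Φ(u) = 0`, the Leibniz rule shows that `u ▷
f` kills all vector fields, hence kills `u` itself, so `(u ▷ f)² = 0` and `u ▷ f = 0`.

Nonzero elements of `K` come from a dimension count (`bot_lt_K`). The brackets `⟦a, …, ⟦a, s(a.b)⟧⟧`
lie in `J` and act locally by square matrices of size `dim M`, so more than `(dim M)²` of them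
satisfy a relation as operators. The same combination in `g` is nonzero: the leading terms `[a, …,
[a, b]]` have distinct degrees and are detected by a representation by 2×2 matrices wherever a minor
`d = a f₁ * b f₂ - a f₂ * b f₁` is nonzero. Smooth functions have zero divisors, so everything is
done up to factors `d` and a cutoff `χ`, and reducedness of the ring removes powers. In dimension at
least two, coordinate fields have a nonzero minor; a nonzero curvature also forces one, being
bilinear and alternating. The local frames for derivations come from Hadamard's lemma. -/

theorem tprod_induction {P : TAlg k R → Prop}
    (tprod : ∀ n v, P (TensorAlgebra.tprod R (VField k R) n v))
    (add : ∀ U V, P U → P V → P (U + V)) (smul : ∀ (f : R) U, P U → P (f • U))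
    (U : TAlg k R) : P U := by
  have zero : P 0 := by simpa using smul 0 _ (tprod 0 (fun _ => 0))
  rw [← TensorAlgebra.ofDirectSum_toDirectSum U]
  induction TensorAlgebra.toDirectSum U using DirectSum.induction_on with
  | zero => simpa using zero
  | of n x =>
    induction x using PiTensorProduct.induction_on with
    | smul_tprod f v =>
      have h := smul f _ (tprod n v)
      rw [← TensorAlgebra.ofDirectSum_of_tprod, ← map_smul] at h
      convert h using 2
      exact (DirectSum.lof R ℕ (fun n => ⨂[R]^n (VField k R)) n).map_smul f _
    | add x y hx hy => rw [map_add, map_add]; exact add _ _ hx hy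
  | add x y hx hy => rw [map_add]; exact add _ _ hx hy

theorem act_tprod (n : ℕ) (v : Fin n → VField k R) (w : W) :
    act nabla D (TensorAlgebra.tprod R (VField k R) n v) w = iterCov nabla D w n v := by
  have h : TensorAlgebra.toDirectSum (TensorAlgebra.tprod R (VField k R) n v) =
      DirectSum.lof R ℕ (fun n => ⨂[R]^n (VField k R)) n (PiTensorProduct.tprod R v) := by
    rw [TensorAlgebra.tprod_apply]
    exact TensorAlgebra.toDirectSum_tensorPower_tprod v
  simp only [act, LinearMap.coe_mk, AddHom.coe_mk]
  rw [h, DirectSum.toModule_lof, PiTensorProduct.lift.tprod]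

theorem tprod_cons (n : ℕ) (X : VField k R) (v : Fin n → VField k R) :
    TensorAlgebra.tprod R (VField k R) (n + 1) (Fin.cons X v) =
      TensorAlgebra.ι R X * TensorAlgebra.tprod R (VField k R) n v := by
  simp [TensorAlgebra.tprod_apply, List.ofFn_succ]

theorem deriv_zero (X : VField k R) : deriv nabla X (0 : TAlg k R) = 0 := by
  simpa using deriv_smul_ground nabla X (0 : k) 0

theorem deriv_one (X : VField k R) : deriv nabla X (1 : TAlg k R) = 0 := by
  simpa using deriv_algebraMap nabla X 1

theorem deriv_sub (X : VField k R) (U V : TAlg k R) :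
    deriv nabla X (U - V) = deriv nabla X U - deriv nabla X V := by
  rw [eq_sub_iff_add_eq, ← deriv_add, sub_add_cancel]

theorem deriv_tprod (X : VField k R) (n : ℕ) (v : Fin n → VField k R) :
    deriv nabla X (TensorAlgebra.tprod R (VField k R) n v) =
      ∑ i, TensorAlgebra.tprod R (VField k R) n (Function.update v i (nabla.cov X (v i))) := by
  induction n with
  | zero => simp [TensorAlgebra.tprod_apply, deriv_one]
  | succ n ih =>
    induction v using Fin.consCases with
    | cons Y v =>
      rw [tprod_cons, deriv_mul, deriv_ι, ih, Fin.sum_univ_succ, Finset.mul_sum]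
      congr 1
      · simp [Fin.update_cons_zero]
      · refine Finset.sum_congr rfl fun i _ => ?_
        rw [← Fin.cons_update, tprod_cons, Fin.cons_succ]

theorem act_one (w : W) : act nabla D 1 w = w := by
  have h := act_tprod nabla D 0 (fun _ => 0) w
  rw [TensorAlgebra.tprod_apply] at h
  simpa [iterCov] using h

/-- `(X · U) ▷ w = X ▷ (U ▷ w) - (X ▷ U) ▷ w`. -/
theorem act_ι_mul (X : VField k R) (U : TAlg k R) (w : W) :
    act nabla D (TensorAlgebra.ι R X * U) w =
      D.cov X (act nabla D U w) - act nabla D (deriv nabla X U) w := by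
  induction U using tprod_induction with
  | tprod n v =>
    rw [← tprod_cons, act_tprod, act_tprod, deriv_tprod, map_sum, LinearMap.sum_apply]
    simp_rw [act_tprod]
    simp [iterCov, covTensor]
  | add U V hU hV =>
    simp only [mul_add, map_add, LinearMap.add_apply, hU, hV, deriv_add]
    abel
  -- The Leibniz terms `X f • (U ▷ w)` of the two summands on the right cancel, so their difference
  -- is `R`-linear in `U`.
  | smul f U hU =>
    simp only [mul_smul_comm, map_smul, LinearMap.smul_apply, hU, deriv_smul, D.leibniz, map_add,
      LinearMap.add_apply, smul_sub]
    abel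

theorem act_ι (X : VField k R) (w : W) : act nabla D (TensorAlgebra.ι R X) w = D.cov X w := by
  have h := act_ι_mul nabla D X 1 w
  rwa [mul_one, deriv_one, act_one, map_zero, LinearMap.zero_apply, sub_zero] at h

/-- Linear maps that commute with the connections commute with the higher-order covariant
derivatives. -/
theorem act_naturality {W' : Type*} [AddCommGroup W'] [Module k W'] [Module R W']
    [IsScalarTower k R W'] (D' : Connection k R W') (φ : W →ₗ[R] W')
    (h : ∀ X w, φ (D.cov X w) = D'.cov X (φ w)) (U : TAlg k R) (w : W) :
    φ (act nabla D U w) = act nabla D' U (φ w) := by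
  have key : ∀ n v, φ (iterCov nabla D w n v) = iterCov nabla D' (φ w) n v := by
    intro n
    induction n with
    | zero => intro v; simp [iterCov]
    | succ n ih => intro v; simp [iterCov, covTensor, ih, h]
  induction U using tprod_induction with
  | tprod n v => rw [act_tprod, act_tprod, key]
  | add U V hU hV => simp only [map_add, LinearMap.add_apply, hU, hV]
  | smul f U hU => simp only [map_smul, LinearMap.smul_apply, hU]

end act

/-! ### Left-normed brackets span the free Lie algebra -/

/-- The span of the left-normed brackets of `n + 1` vector fields. -/
def leftNormed (k R : Type*) [CommRing k] [CommRing R] [Algebra k R] :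
    ℕ → Submodule R (TAlg k R)
  | 0 => LinearMap.range (TensorAlgebra.ι R (M := VField k R))
  | n + 1 => Submodule.span R
      {U | ∃ X : VField k R, ∃ u ∈ leftNormed k R n, U = ⁅TensorAlgebra.ι R X, u⁆}

theorem lie_mem_leftNormed {n : ℕ} (X : VField k R) {u : TAlg k R} (hu : u ∈ leftNormed k R n) :
    ⁅TensorAlgebra.ι R X, u⁆ ∈ leftNormed k R (n + 1) :=
  Submodule.subset_span ⟨X, u, hu, rfl⟩

theorem deriv_lie (nabla : AffineConnection k R) (X : VField k R) (U V : TAlg k R) :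
    deriv nabla X ⁅U, V⁆ = ⁅deriv nabla X U, V⁆ + ⁅U, deriv nabla X V⁆ := by
  simp only [LieRing.of_associative_ring_bracket]
  rw [deriv_sub, deriv_mul, deriv_mul]
  abel

theorem deriv_mem_leftNormed (nabla : AffineConnection k R) (X : VField k R) (n : ℕ)
    {u : TAlg k R} (hu : u ∈ leftNormed k R n) : deriv nabla X u ∈ leftNormed k R n := by
  induction n generalizing u with
  | zero =>
    obtain ⟨Y, rfl⟩ := hu
    exact ⟨nabla.cov X Y, (deriv_ι nabla X Y).symm⟩
  | succ n ih =>
    refine Submodule.span_induction (p := fun u _ => deriv nabla X u ∈ leftNormed k R (n + 1))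
      ?_ ?_ ?_ ?_ hu
    · rintro _ ⟨Y, u, hu, rfl⟩
      rw [deriv_lie, deriv_ι]
      exact add_mem (lie_mem_leftNormed _ hu) (lie_mem_leftNormed _ (ih hu))
    · rw [deriv_zero]; exact zero_mem _
    · intro u v _ _ hu hv
      rw [deriv_add]; exact add_mem hu hv
    · intro f u hu' hu
      rw [deriv_smul]
      exact add_mem (Submodule.smul_mem _ _ hu') (Submodule.smul_mem _ _ hu)

/-- Induction on the length of the left factor, by the Jacobi identity `⁅⁅Y, u⁆, v⁆ = ⁅Y, ⁅u, v⁆⁆ -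
⁅u, ⁅Y, v⁆⁆`. -/
theorem lie_mem_iSup_leftNormed (n : ℕ) {u v : TAlg k R} (hu : u ∈ leftNormed k R n)
    (hv : v ∈ ⨆ m, leftNormed k R m) : ⁅u, v⁆ ∈ ⨆ m, leftNormed k R m := by
  induction n generalizing u v with
  | zero =>
    obtain ⟨X, rfl⟩ := hu
    induction hv using Submodule.iSup_induction' with
    | mem m v hv => exact Submodule.mem_iSup_of_mem (m + 1) (lie_mem_leftNormed X hv)
    | zero => rw [lie_zero]; exact zero_mem _
    | add v w _ _ hv hw => rw [lie_add]; exact add_mem hv hw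
  | succ n ih =>
    have ih0 : ∀ (X : VField k R) {v : TAlg k R}, v ∈ ⨆ m, leftNormed k R m →
        ⁅TensorAlgebra.ι R X, v⁆ ∈ ⨆ m, leftNormed k R m := by
      intro X v hv
      induction hv using Submodule.iSup_induction' with
      | mem m v hv => exact Submodule.mem_iSup_of_mem (m + 1) (lie_mem_leftNormed X hv)
      | zero => rw [lie_zero]; exact zero_mem _
      | add v w _ _ hv hw => rw [lie_add]; exact add_mem hv hw
    refine Submodule.span_induction (p := fun u _ => ⁅u, v⁆ ∈ ⨆ m, leftNormed k R m)
      ?_ ?_ ?_ ?_ hu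
    · rintro _ ⟨Y, u, hu, rfl⟩
      rw [lie_lie]
      exact sub_mem (ih0 Y (ih hu hv)) (ih hu (ih0 Y hv))
    · rw [zero_lie]; exact zero_mem _
    · intro u w _ _ hu hw
      rw [add_lie]; exact add_mem hu hw
    · intro f u _ hu
      rw [smul_lie]; exact Submodule.smul_mem _ _ hu

theorem freeLie_le_iSup_leftNormed {u : TAlg k R} (hu : u ∈ FreeLie k R) :
    u ∈ ⨆ m, leftNormed k R m := by
  induction hu using LieSubalgebra.lieSpan_induction with
  | mem U h =>
    obtain ⟨Y, rfl⟩ := h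
    exact Submodule.mem_iSup_of_mem 0 ⟨Y, rfl⟩
  | zero => exact zero_mem _
  | add U V hU hV h1 h2 => exact add_mem h1 h2
  | smul f U hU h1 => exact Submodule.smul_mem _ _ h1
  | lie U V hU hV h1 h2 =>
    clear hU
    induction h1 using Submodule.iSup_induction' with
    | mem m u hu => exact lie_mem_iSup_leftNormed m hu h2
    | zero => rw [zero_lie]; exact zero_mem _
    | add v w _ _ hv hw =>
      rw [add_lie]
      exact add_mem hv hw

/-- Covariant derivatives preserve the length of left-normed brackets, so in the bracket step the
hypothesis is available for `X ▷ u` as well as for `u`. The formula for the action of `⁅X, u⁆`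
involves both. -/
theorem freeLie_induction (nabla : AffineConnection k R) {P : TAlg k R → Prop}
    (ι : ∀ X, P (TensorAlgebra.ι R X)) (add : ∀ u v, P u → P v → P (u + v))
    (smul : ∀ (f : R) u, P u → P (f • u))
    (lie : ∀ X u, P u → P (deriv nabla X u) → P ⁅TensorAlgebra.ι R X, u⁆)
    {u : TAlg k R} (hu : u ∈ FreeLie k R) : P u := by
  have zero : P 0 := by simpa using smul 0 _ (ι 0)
  have key : ∀ n, ∀ u ∈ leftNormed k R n, P u := by
    intro n
    induction n with
    | zero => rintro _ ⟨X, rfl⟩; exact ι X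
    | succ n ih =>
      intro u hu
      refine Submodule.span_induction (p := fun u _ => P u) ?_ zero
        (fun u v _ _ => add u v) (fun f u _ => smul f u) hu
      rintro _ ⟨Y, u, hu, rfl⟩
      exact lie Y u (ih u hu) (ih _ (deriv_mem_leftNormed nabla Y n hu))
  have h := freeLie_le_iSup_leftNormed hu
  clear hu
  induction h using Submodule.iSup_induction' with
  | mem n u hu => exact key n u hu
  | zero => exact zero
  | add v w _ _ hv hw => exact add v w hv hw

/-! ### The action of primitive elements -/

section primitive

variable (nabla : AffineConnection k R)

/-- The connection on the tensor algebra. -/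
def algConnection : Connection k R (TAlg k R) where
  cov :=
    { toFun := fun X =>
        { toFun := deriv nabla X
          map_add' := deriv_add nabla X
          map_smul' := deriv_smul_ground nabla X }
      map_add' := fun X Y => by ext u; simp [deriv_add_left]
      map_smul' := fun f X => by ext u; simp [deriv_smul_left] }
  leibniz := deriv_smul nabla

theorem algConnection_cov (X : VField k R) (U : TAlg k R) :
    (algConnection nabla).cov X U = deriv nabla X U := rfl

theorem act_alg_ι (U : TAlg k R) (X : VField k R) :
    act nabla (algConnection nabla) U (TensorAlgebra.ι R X) =
      TensorAlgebra.ι R (act nabla nabla U X) :=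
  (act_naturality nabla nabla (algConnection nabla) (TensorAlgebra.ι R)
    (fun X Y => (deriv_ι nabla X Y).symm) U X).symm

theorem coe_tri (u v : FreeLie k R) :
    (tri nabla u v : TAlg k R) = act nabla (algConnection nabla) u v :=
  act_naturality nabla (freeLieConnection nabla) (algConnection nabla)
    (FreeLie k R).toSubmodule.subtype (fun _ _ => rfl) u v

variable {W : Type*} [AddCommGroup W] [Module k W] [Module R W] [IsScalarTower k R W]
variable (D : Connection k R W)

/-- `u` acts on products `u · U` as a primitive element of the tensor algebra does. -/
def IsPrimitiveFor (u : TAlg k R) : Prop :=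
  ∀ U w, act nabla D (u * U) w =
    act nabla D u (act nabla D U w) - act nabla D (act nabla (algConnection nabla) u U) w

/-- `u` acts by a derivation of the tensor algebra. -/
def ActsByDerivation (u : TAlg k R) : Prop :=
  ∀ U V, act nabla (algConnection nabla) u (U * V) =
    act nabla (algConnection nabla) u U * V + U * act nabla (algConnection nabla) u V

variable {nabla D}

/-- The last two terms are `-(u * X) ▷ w`, expanded by primitivity of `u`. -/
theorem IsPrimitiveFor.act_lie {X : VField k R} {u : TAlg k R} (hu : IsPrimitiveFor nabla D u)
    (w : W) : act nabla D ⁅TensorAlgebra.ι R X, u⁆ w =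
      D.cov X (act nabla D u w) - act nabla D (deriv nabla X u) w -
        act nabla D u (D.cov X w) + D.cov (act nabla nabla u X) w := by
  rw [LieRing.of_associative_ring_bracket, map_sub, LinearMap.sub_apply, act_ι_mul, hu,
    act_alg_ι, act_ι, act_ι]
  abel

/-- By `act_lie`, the operator of `⁅X, u⁆` is a commutator of two derivations, minus that of `X ▷
u`, plus that of the vector field `u ▷ X`. -/
theorem ActsByDerivation.lie {X : VField k R} {u : TAlg k R}
    (hp : IsPrimitiveFor nabla (algConnection nabla) u)
    (hu : ActsByDerivation nabla u) (hX : ActsByDerivation nabla (deriv nabla X u)) :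
    ActsByDerivation nabla ⁅TensorAlgebra.ι R X, u⁆ := by
  intro U V
  simp only [hp.act_lie, hu U V, hX U V, algConnection_cov, deriv_mul,
    hu _ V, hu U _, map_add, mul_add, mul_sub, add_mul, sub_mul]
  abel

theorem IsPrimitiveFor.lie {X : VField k R} {u : TAlg k R}
    (hd : ActsByDerivation nabla u)
    (hp : IsPrimitiveFor nabla (algConnection nabla) u)
    (hu : IsPrimitiveFor nabla D u) (hX : IsPrimitiveFor nabla D (deriv nabla X u)) :
    IsPrimitiveFor nabla D ⁅TensorAlgebra.ι R X, u⁆ := by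
  intro U w
  have h : ⁅TensorAlgebra.ι R X, u⁆ * U =
      TensorAlgebra.ι R X * (u * U) - u * (TensorAlgebra.ι R X * U) := by
    rw [LieRing.of_associative_ring_bracket, sub_mul, mul_assoc, mul_assoc]
  rw [h, hu.act_lie, hp.act_lie, map_sub, LinearMap.sub_apply, act_ι_mul, hu U w,
    hu (TensorAlgebra.ι R X * U) w, hd,
    act_alg_ι, deriv_mul]
  simp only [map_sub, map_add, LinearMap.sub_apply, LinearMap.add_apply, act_ι_mul, hu _ w, hX _ w,
    algConnection_cov]
  abel

/-- The three properties need a joint induction: for a bracket, the derivation property uses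
primitivity on the tensor algebra, and primitivity on `W` uses both. -/
theorem primitive_of_mem_freeLie (nabla : AffineConnection k R) (D : Connection k R W)
    {u : TAlg k R} (hu : u ∈ FreeLie k R) :
    ActsByDerivation nabla u ∧ IsPrimitiveFor nabla (algConnection nabla) u ∧
      IsPrimitiveFor nabla D u := by
  refine freeLie_induction nabla (P := fun u => ActsByDerivation nabla u ∧
    IsPrimitiveFor nabla (algConnection nabla) u ∧ IsPrimitiveFor nabla D u) ?ι ?add ?smul ?lie hu
  case ι =>
    intro X
    refine ⟨fun U V => ?_, fun U w => ?_, fun U w => ?_⟩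
    · simp only [act_ι, algConnection_cov, deriv_mul]
    · simp only [act_ι_mul, act_ι]; rfl
    · simp only [act_ι_mul, act_ι]; rfl
  case add =>
    intro u v hu hv
    refine ⟨fun U V => ?_, fun U w => ?_, fun U w => ?_⟩
    · simp only [map_add, LinearMap.add_apply, hu.1 U V, hv.1 U V, add_mul, mul_add]; abel
    · simp only [add_mul, map_add, LinearMap.add_apply, hu.2.1 U w, hv.2.1 U w]; abel
    · simp only [add_mul, map_add, LinearMap.add_apply, hu.2.2 U w, hv.2.2 U w]; abel
  case smul =>
    intro f u hu
    refine ⟨fun U V => ?_, fun U w => ?_, fun U w => ?_⟩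
    · simp only [map_smul, LinearMap.smul_apply, hu.1 U V, smul_add, smul_mul_assoc,
        mul_smul_comm]
    · simp only [map_smul, LinearMap.smul_apply, hu.2.1 U w, smul_sub, smul_mul_assoc]
    · simp only [map_smul, LinearMap.smul_apply, hu.2.2 U w, smul_sub, smul_mul_assoc]
  case lie =>
    intro X u hu hX
    exact ⟨hu.1.lie hu.2.1 hX.1, IsPrimitiveFor.lie hu.1 hu.2.1 hu.2.1 hX.2.1,
      IsPrimitiveFor.lie hu.1 hu.2.1 hu.2.2 hX.2.2⟩

/-- `u ▷ (f w) = (u ▷ f) w + f (u ▷ w)` for `u` in the free Lie algebra. -/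
theorem act_smul_of_mem_freeLie (nabla : AffineConnection k R) (D : Connection k R W)
    {u : TAlg k R} (hu : u ∈ FreeLie k R) (f : R) (w : W) :
    act nabla D u (f • w) =
      act nabla (trivialConnection k R) u f • w + f • act nabla D u w := by
  -- Membership is carried through the induction because the bracket case needs primitivity of `u`.
  have key : u ∈ FreeLie k R ∧ ∀ (f : R) (w : W), act nabla D u (f • w) =
      act nabla (trivialConnection k R) u f • w + f • act nabla D u w := by
    refine freeLie_induction nabla (P := fun u => u ∈ FreeLie k R ∧ ∀ (f : R) (w : W),
      act nabla D u (f • w) = act nabla (trivialConnection k R) u f • w + f • act nabla D u w)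
      ?ι ?add ?smul ?lie hu
    case ι =>
      intro X
      refine ⟨LieSubalgebra.subset_lieSpan ⟨X, rfl⟩, fun f w => ?_⟩
      rw [act_ι, act_ι, act_ι, D.leibniz]
      rfl
    case add =>
      intro u v hu hv
      refine ⟨add_mem hu.1 hv.1, fun f w => ?_⟩
      simp only [map_add, LinearMap.add_apply, hu.2, hv.2, add_smul, smul_add]
      abel
    case smul =>
      intro g u hu
      refine ⟨(FreeLie k R).smul_mem g hu.1, fun f w => ?_⟩
      simp only [map_smul, LinearMap.smul_apply, hu.2, smul_add, smul_assoc]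
      rw [smul_comm g f]
    case lie =>
      intro X u hu hX
      refine ⟨(FreeLie k R).lie_mem (LieSubalgebra.subset_lieSpan ⟨X, rfl⟩) hu.1, fun f w => ?_⟩
      have h1 := (primitive_of_mem_freeLie nabla D hu.1).2.2
      have h2 := (primitive_of_mem_freeLie nabla (trivialConnection k R) hu.1).2.2
      have h3 : ∀ (Y : VField k R) (g : R), (trivialConnection k R).cov Y g = Y g :=
        fun _ _ => rfl
      rw [h1.act_lie, h1.act_lie, h2.act_lie, hu.2, D.leibniz, D.leibniz, map_add, map_add,
        D.leibniz, D.leibniz, hX.2, hu.2, hu.2, h3, h3, h3]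
      simp only [add_smul, sub_smul, smul_add, smul_sub]
      abel
  exact key.2 f w

/-- Primitivity says that `u * v + u ▷ v` acts as the composite of `u` and `v`; the Grossman–Larson
bracket is its antisymmetrisation. -/
theorem act_glBracket (nabla : AffineConnection k R) (D : Connection k R W)
    (u v : FreeLie k R) (w : W) :
    act nabla D (glBracket nabla u v : TAlg k R) w =
      act nabla D u (act nabla D v w) - act nabla D v (act nabla D u w) := by
  have hu := (primitive_of_mem_freeLie nabla D u.2).2.2
  have hv := (primitive_of_mem_freeLie nabla D v.2).2.2
  have h : (glBracket nabla u v : TAlg k R) = (u : TAlg k R) * v - (v : TAlg k R) * u +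
      act nabla (algConnection nabla) u v - act nabla (algConnection nabla) v u := by
    simp only [glBracket, AddSubgroupClass.coe_sub, AddMemClass.coe_add,
      LieSubalgebra.coe_bracket,      LieRing.of_associative_ring_bracket, coe_tri]
  rw [h]
  simp only [map_add, map_sub, LinearMap.add_apply, LinearMap.sub_apply, hu _ w, hv _ w]
  abel

end primitive

/-! ### The kernels of the actions -/

section kernels

variable (nabla : AffineConnection k R)

theorem Phi_glBracket (u v : FreeLie k R) (a : VField k R) :
    Phi nabla (glBracket nabla u v) a =
      Phi nabla u (Phi nabla v a) - Phi nabla v (Phi nabla u a) :=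
  act_glBracket nabla nabla u v a

theorem rho_glBracket (u v : FreeLie k R) (f : R) :
    rho nabla (glBracket nabla u v) f =
      rho nabla u (rho nabla v f) - rho nabla v (rho nabla u f) :=
  act_glBracket nabla (trivialConnection k R) u v f

theorem Phi_smul_right (u : FreeLie k R) (f : R) (a : VField k R) :
    Phi nabla u (f • a) = rho nabla u f • a + f • Phi nabla u a :=
  act_smul_of_mem_freeLie nabla nabla u.2 f a

theorem Phi_inc (a b : VField k R) : Phi nabla (inc a) b = nabla.cov a b :=
  act_ι nabla nabla a b

theorem rho_inc (a : VField k R) (f : R) : rho nabla (inc a) f = a f :=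
  act_ι nabla (trivialConnection k R) a f

theorem mem_J {u : FreeLie k R} : u ∈ J nabla ↔ ∀ f, rho nabla u f = 0 :=
  LinearMap.mem_ker.trans LinearMap.ext_iff

theorem mem_K {u : FreeLie k R} : u ∈ K nabla ↔ ∀ a, Phi nabla u a = 0 :=
  LinearMap.mem_ker.trans LinearMap.ext_iff

theorem Phi_smul_of_mem_J {u : FreeLie k R} (hu : u ∈ J nabla) (f : R) (a : VField k R) :
    Phi nabla u (f • a) = f • Phi nabla u a := by
  rw [Phi_smul_right, (mem_J nabla).1 hu, zero_smul, zero_add]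

theorem isGLIdeal_K : IsGLIdeal nabla (K nabla) := by
  intro u v hv
  rw [mem_K] at hv
  constructor <;> rw [mem_K] <;> intro a <;> simp [Phi_glBracket, hv]

theorem Phi_curvElt (a b c : VField k R) :
    Phi nabla (curvElt nabla a b) c = curvature nabla a b c := by
  simp [curvElt, curvature, Phi_glBracket, Phi_inc]

theorem curvElt_mem_J (a b : VField k R) : curvElt nabla a b ∈ J nabla := by
  rw [mem_J]
  intro f
  simp [curvElt, rho_glBracket, rho_inc, Derivation.commutator_apply]

theorem smul_eq_zero_of_annihilates {h : R} (hh : ∀ X : VField k R, h • X = 0)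
    (u : FreeLie k R) : h • u = 0 := by
  obtain ⟨u, hu⟩ := u
  ext1
  change h • u = 0
  induction hu using LieSubalgebra.lieSpan_induction with
  | mem U h =>
    obtain ⟨Y, rfl⟩ := h
    rw [← map_smul, hh, map_zero]
  | zero => exact smul_zero _
  | add U V hU hV h1 h2 => rw [smul_add, h1, h2, add_zero]
  | smul f U hU h1 => rw [smul_comm, h1, smul_zero]
  | lie U V hU hV h1 h2 => rw [← smul_lie h U V, h1, zero_lie]

/-- The module of vector fields need not be faithful (in dimension zero it vanishes), so `(u ▷ f) X
= 0` for all `X` is not enough by itself. But then `(u ▷ f) • u = 0`, and applying this to `f` gives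
`(u ▷ f)² = 0`. -/
theorem K_le_J [IsReduced R] : K nabla ≤ J nabla := by
  intro u hu
  rw [mem_K] at hu
  rw [mem_J]
  intro f
  have h : ∀ X : VField k R, rho nabla u f • X = 0 := by
    intro X
    have h1 := Phi_smul_right nabla u f X
    rwa [hu, hu, smul_zero, add_zero, eq_comm] at h1
  have h2 : rho nabla u f * rho nabla u f = 0 := by
    have h3 := smul_eq_zero_of_annihilates h u
    rw [← smul_eq_mul, ← LinearMap.smul_apply, ← map_smul, h3, map_zero, LinearMap.zero_apply]
  exact IsReduced.eq_zero _ ⟨2, by rw [sq, h2]⟩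

/-- Under `Φ` the double commutators of `∇a`, `∇b`, `∇c` cancel by the Jacobi identity for
operators, the commutators `[∇a, ∇⁅b, c⁆]` cancel against those in `s(a.⁅b, c⁆)`, and the remaining
terms cancel by the Jacobi identity for vector fields. -/
theorem bianchi_mem_K (a b c : VField k R) :
    glBracket nabla (inc a) (curvElt nabla b c) + glBracket nabla (inc b) (curvElt nabla c a) +
      glBracket nabla (inc c) (curvElt nabla a b) + curvElt nabla a ⁅b, c⁆ +
      curvElt nabla b ⁅c, a⁆ + curvElt nabla c ⁅a, b⁆ ∈ K nabla := by
  rw [mem_K]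
  intro d
  have jac : nabla.cov ⁅a, ⁅b, c⁆⁆ d + nabla.cov ⁅b, ⁅c, a⁆⁆ d + nabla.cov ⁅c, ⁅a, b⁆⁆ d = 0 := by
    rw [← LinearMap.add_apply, ← LinearMap.add_apply, ← map_add, ← map_add, lie_jacobi, map_zero,
      LinearMap.zero_apply]
  simp only [map_add, LinearMap.add_apply, Phi_glBracket, Phi_curvElt, Phi_inc, curvature,
    map_sub]
  rw [← sub_eq_zero.2 jac.symm]
  abel

theorem curvElt_sub_right (a b c : VField k R) :
    curvElt nabla a (b - c) = curvElt nabla a b - curvElt nabla a c := by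
  simp only [curvElt, glBracket, tri, map_sub, lie_sub, AddSubgroupClass.coe_sub,
    LinearMap.sub_apply]
  abel

/-- The two forms are equal in `g`, since `b ▷ c - c ▷ b - t(b.c) = ⁅b, c⁆` and `s` is additive in
its second argument. -/
theorem bianchi_torsion_mem_K (a b c : VField k R) :
    glBracket nabla (inc a) (curvElt nabla b c) + glBracket nabla (inc b) (curvElt nabla c a) +
      glBracket nabla (inc c) (curvElt nabla a b) - curvElt nabla a (torsion nabla b c) -
      curvElt nabla b (torsion nabla c a) - curvElt nabla c (torsion nabla a b) +
      curvElt nabla a (nabla.cov b c - nabla.cov c b) +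
      curvElt nabla b (nabla.cov c a - nabla.cov a c) +
      curvElt nabla c (nabla.cov a b - nabla.cov b a) ∈ K nabla := by
  convert bianchi_mem_K nabla a b c using 1
  simp only [torsion, curvElt_sub_right]
  abel

end kernels

/-! ### Nontrivial elements of the kernel of `Φ` -/

section filtration

/-- The elements of degree at most `n` of the tensor algebra. -/
def filt (k R : Type*) [CommRing k] [CommRing R] [Algebra k R] (n : ℕ) :
    Submodule R (TAlg k R) :=
  (1 ⊔ LinearMap.range (TensorAlgebra.ι R (M := VField k R))) ^ n

theorem ι_mem_filt_one (X : VField k R) : TensorAlgebra.ι R X ∈ filt k R 1 := by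
  rw [filt, pow_one]
  exact Submodule.mem_sup_right ⟨X, rfl⟩

theorem mul_mem_filt {m n : ℕ} {U V : TAlg k R} (hU : U ∈ filt k R m) (hV : V ∈ filt k R n) :
    U * V ∈ filt k R (m + n) := by
  rw [filt, pow_add]
  exact Submodule.mul_mem_mul hU hV

theorem filt_mono {m n : ℕ} (h : m ≤ n) : filt k R m ≤ filt k R n := by
  obtain ⟨l, rfl⟩ := Nat.exists_eq_add_of_le h
  intro U hU
  have h1 : (1 : TAlg k R) ∈ filt k R l :=
    Submodule.one_le.1 (one_le_pow_of_one_le' le_sup_left l)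
  simpa using mul_mem_filt hU h1

theorem lie_mem_filt {m : ℕ} (X : VField k R) {U : TAlg k R} (hU : U ∈ filt k R m) :
    ⁅TensorAlgebra.ι R X, U⁆ ∈ filt k R (m + 1) := by
  rw [LieRing.of_associative_ring_bracket]
  refine sub_mem ?_ (mul_mem_filt hU (ι_mem_filt_one X))
  rw [add_comm]
  exact mul_mem_filt (ι_mem_filt_one X) hU

theorem filt_induction {P : ℕ → TAlg k R → Prop}
    (algebraMap : ∀ m (f : R), P m (algebraMap R _ f)) (ι : ∀ X, P 1 (TensorAlgebra.ι R X))
    (add : ∀ m U V, P m U → P m V → P m (U + V))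
    (mul : ∀ m U V, U ∈ filt k R 1 → V ∈ filt k R m → P 1 U → P m V → P (m + 1) (U * V))
    {n : ℕ} {U : TAlg k R} (hU : U ∈ filt k R n) : P n U := by
  have h1 : ∀ U ∈ filt k R 1, P 1 U := by
    intro U hU
    rw [filt, pow_one] at hU
    obtain ⟨_, hV, _, ⟨X, rfl⟩, rfl⟩ := Submodule.mem_sup.1 hU
    obtain ⟨f, rfl⟩ := Submodule.mem_one.1 hV
    exact add _ _ _ (algebraMap _ _) (ι _)
  induction n generalizing U with
  | zero =>
    rw [filt, pow_zero] at hU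
    obtain ⟨f, rfl⟩ := Submodule.mem_one.1 hU
    exact algebraMap _ _
  | succ n ih =>
    rw [filt, pow_succ'] at hU
    refine Submodule.mul_induction_on hU ?_ (add _)
    intro U hU V hV
    have hU' : U ∈ filt k R 1 := by rwa [filt, pow_one]
    exact mul n U V hU' hV (h1 U hU') (ih hV)

theorem deriv_mem_filt (nabla : AffineConnection k R) (X : VField k R) {n : ℕ} {U : TAlg k R}
    (hU : U ∈ filt k R n) : deriv nabla X U ∈ filt k R n := by
  refine filt_induction (P := fun n U => deriv nabla X U ∈ filt k R n) ?_ ?_ ?_ ?_ hU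
  · intro m f
    rw [deriv_algebraMap]
    refine filt_mono (Nat.zero_le m) ?_
    rw [filt, pow_zero]
    exact Submodule.mem_one.2 ⟨_, rfl⟩
  · intro Y
    rw [deriv_ι]
    exact ι_mem_filt_one _
  · intro m U V hU hV
    rw [deriv_add]
    exact add_mem hU hV
  · intro m U V hU hV hU' hV'
    rw [deriv_mul, add_comm m]
    exact add_mem (mul_mem_filt hU' hV) (mul_mem_filt hU hV')

end filtration

/-! ### Iterated curvature elements and their leading terms -/

section curvIter

/-- The iterated commutators `[a, …, [a, b]]` in the tensor algebra. -/
def adIter (a b : VField k R) : ℕ → TAlg k R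
  | 0 => ⁅TensorAlgebra.ι R a, TensorAlgebra.ι R b⁆
  | n + 1 => ⁅TensorAlgebra.ι R a, adIter a b n⁆

theorem adIter_mem_filt (a b : VField k R) (n : ℕ) : adIter a b n ∈ filt k R (n + 2) := by
  induction n with
  | zero => exact lie_mem_filt a (ι_mem_filt_one b)
  | succ n ih => exact lie_mem_filt a ih

variable (nabla : AffineConnection k R)

/-- The iterated Grossman–Larson brackets `⟦a, …, ⟦a, s(a.b)⟧⟧`. -/
def curvIter (a b : VField k R) : ℕ → FreeLie k R
  | 0 => curvElt nabla a b
  | n + 1 => glBracket nabla (inc a) (curvIter a b n)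

theorem curvIter_mem_J (a b : VField k R) (n : ℕ) : curvIter nabla a b n ∈ J nabla := by
  induction n with
  | zero => exact curvElt_mem_J nabla a b
  | succ n ih =>
    rw [mem_J] at ih ⊢
    intro f
    rw [curvIter, rho_glBracket, ih, ih, map_zero, sub_zero]

theorem coe_glBracket_inc (a : VField k R) (u : FreeLie k R) :
    (glBracket nabla (inc a) u : TAlg k R) =
      ⁅TensorAlgebra.ι R a, (u : TAlg k R)⁆ + deriv nabla a u -
        TensorAlgebra.ι R (Phi nabla u a) := by
  have h : ((inc a : FreeLie k R) : TAlg k R) = TensorAlgebra.ι R a := rfl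
  simp only [glBracket, AddSubgroupClass.coe_sub, AddMemClass.coe_add, LieSubalgebra.coe_bracket,
    coe_tri, h, act_ι, act_alg_ι]
  rfl

/-- The Grossman–Larson bracket with `a` differs from the commutator with `a` by a covariant
derivative and a vector field, neither of which raises the degree beyond that of `curvIter nabla a b
n`. -/
theorem curvIter_sub_adIter_mem_filt (a b : VField k R) (n : ℕ) :
    (curvIter nabla a b n : TAlg k R) - adIter a b n ∈ filt k R (n + 1) := by
  induction n with
  | zero =>
    have h : (curvIter nabla a b 0 : TAlg k R) - adIter a b 0 =
        TensorAlgebra.ι R (nabla.cov a b - Phi nabla (inc b) a - ⁅a, b⁆) := by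
      have h : ∀ b : VField k R, ((inc b : FreeLie k R) : TAlg k R) = TensorAlgebra.ι R b :=
        fun _ => rfl
      rw [curvIter, curvElt, AddSubgroupClass.coe_sub, coe_glBracket_inc, adIter, h, h, deriv_ι,
        map_sub, map_sub]
      abel
    rw [h]
    exact ι_mem_filt_one _
  | succ n ih =>
    have h : (curvIter nabla a b (n + 1) : TAlg k R) - adIter a b (n + 1) =
        ⁅TensorAlgebra.ι R a, (curvIter nabla a b n : TAlg k R) - adIter a b n⁆ +
          deriv nabla a (curvIter nabla a b n) -
          TensorAlgebra.ι R (Phi nabla (curvIter nabla a b n) a) := by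
      rw [curvIter, coe_glBracket_inc, adIter, lie_sub]
      abel
    rw [h]
    refine sub_mem (add_mem (lie_mem_filt a ih) (deriv_mem_filt nabla a ?_))
      (filt_mono (by omega) (ι_mem_filt_one _))
    have h2 := add_mem (filt_mono (Nat.le_succ _) ih) (adIter_mem_filt a b n)
    rwa [sub_add_cancel] at h2

theorem curvIter_mem_filt (a b : VField k R) (n : ℕ) :
    (curvIter nabla a b n : TAlg k R) ∈ filt k R (n + 2) := by
  have h2 := add_mem (filt_mono (Nat.le_succ _) (curvIter_sub_adIter_mem_filt nabla a b n))
    (adIter_mem_filt a b n)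
  rwa [sub_add_cancel] at h2

end curvIter

/-! ### Detecting leading terms by polynomial matrices -/

section detect

open Polynomial

variable (φ ψ : VField k R →ₗ[R] R)

/-- The representation of the tensor algebra by polynomial matrices for which a vector field `X`
acts by `t (φ(X) E₀₀ + ψ(X) E₀₁)`. -/
def matRep : TAlg k R →ₐ[R] Matrix (Fin 2) (Fin 2) R[X] :=
  TensorAlgebra.lift R
    { toFun := fun Y => !![C (φ Y) * X, C (ψ Y) * X; 0, 0]
      map_add' := fun Y Z => by
        ext i j : 2
        fin_cases i <;> fin_cases j <;> simp [add_mul]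
      map_smul' := fun f Y => by
        ext i j : 2
        fin_cases i <;> fin_cases j <;> simp [smul_eq_C_mul, mul_assoc] }

theorem matRep_ι (Y : VField k R) :
    matRep φ ψ (TensorAlgebra.ι R Y) = !![C (φ Y) * X, C (ψ Y) * X; 0, 0] := by
  rw [matRep, TensorAlgebra.lift_ι_apply]
  rfl

/-- The variable records the tensor degree, so one coefficient isolates the leading term of an
element. -/
theorem natDegree_matRep_le {n : ℕ} {U : TAlg k R} (hU : U ∈ filt k R n) :
    ∀ i j, (matRep φ ψ U i j).natDegree ≤ n := by
  refine filt_induction (P := fun n U => ∀ i j, (matRep φ ψ U i j).natDegree ≤ n) ?_ ?_ ?_ ?_ hU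
  · intro m f i j
    rw [AlgHom.commutes, Matrix.algebraMap_matrix_apply]
    split_ifs
    · simp
    · simp
  · intro Y i j
    rw [matRep_ι]
    have h : ∀ f : R, (C f * X).natDegree ≤ 1 := fun f =>
      (natDegree_C_mul_le _ _).trans natDegree_X_le
    fin_cases i <;> fin_cases j <;> simp [h]
  · intro m U V hU hV i j
    rw [map_add]
    exact natDegree_add_le_of_degree_le (hU i j) (hV i j)
  · intro m U V _ _ hU hV i j
    rw [map_mul, Matrix.mul_apply, add_comm]
    exact natDegree_sum_le_of_forall_le _ _ fun l _ => natDegree_mul_le_of_le (hU i l) (hV l j)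

/-- Here `a` and `b` go to `d t E₀₀` and `d t E₀₁`. As `[E₀₀, E₀₁] = E₀₁`, each commutator with `a`
contributes a factor `d t`. -/
theorem matRep_adIter {a b : VField k R} {d : R} (h1 : φ a = d) (h2 : φ b = 0) (h3 : ψ a = 0)
    (h4 : ψ b = d) (n : ℕ) :
    matRep φ ψ (adIter a b n) = !![0, C (d ^ (n + 2)) * X ^ (n + 2); 0, 0] := by
  induction n with
  | zero =>
    rw [adIter, LieRing.of_associative_ring_bracket, map_sub, map_mul, map_mul, matRep_ι,
      matRep_ι, h1, h2, h3, h4]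
    ext i j : 2
    fin_cases i <;> fin_cases j <;> simp
    ring_nf
  | succ n ih =>
    rw [adIter, LieRing.of_associative_ring_bracket, map_sub, map_mul, map_mul, matRep_ι, ih,
      h1, h3]
    ext i j : 2
    fin_cases i <;> fin_cases j <;> simp
    ring_nf

/-- The coefficient of `tⁿ E₀₁` in the representation. -/
def detect (n : ℕ) : TAlg k R →ₗ[R] R where
  toFun U := (matRep φ ψ U 0 1).coeff n
  map_add' U V := by simp
  map_smul' f U := by simp

theorem detect_eq_zero {m n : ℕ} (h : m < n) {U : TAlg k R} (hU : U ∈ filt k R m) :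
    detect φ ψ n U = 0 :=
  coeff_eq_zero_of_natDegree_lt ((natDegree_matRep_le φ ψ hU 0 1).trans_lt h)

theorem detect_curvIter (nabla : AffineConnection k R) {a b : VField k R} {d : R} (h1 : φ a = d)
    (h2 : φ b = 0) (h3 : ψ a = 0) (h4 : ψ b = d) (n : ℕ) :
    detect φ ψ (n + 2) (curvIter nabla a b n) = d ^ (n + 2) := by
  have h5 := detect_eq_zero φ ψ (Nat.lt_succ_self _) (curvIter_sub_adIter_mem_filt nabla a b n)
  rw [map_sub, sub_eq_zero] at h5
  refine h5.trans ?_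
  change (matRep φ ψ (adIter a b n) 0 1).coeff (n + 2) = _
  rw [matRep_adIter φ ψ h1 h2 h3 h4]
  change (C (d ^ (n + 2)) * X ^ (n + 2)).coeff (n + 2) = _
  rw [coeff_C_mul, coeff_X_pow_self, mul_one]

end detect

/-! ### Linear relations among iterated curvature elements -/

/-- The evaluation of vector fields at a function. -/
def evalAt (f : R) : VField k R →ₗ[R] R where
  toFun X := X f
  map_add' _ _ := rfl
  map_smul' _ _ := rfl

theorem evalAt_apply (f : R) (X : VField k R) : evalAt f X = X f := rfl

/-- Downward induction on the index. In degree `n + 2` the earlier terms are invisible to `detect`,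
and after multiplication by `d` the later ones vanish by induction; what remains is `d * h n * d ^
(n + 2) = 0`, and the ring is reduced. -/
theorem curvIter_torsionFree [IsReduced R] (nabla : AffineConnection k R) (a b : VField k R)
    (f₁ f₂ : R) (N : ℕ) (h : ℕ → R)
    (hsum : ∑ i ∈ Finset.range N, h i • curvIter nabla a b i = 0) {n : ℕ} (hn : n < N) :
    (a f₁ * b f₂ - a f₂ * b f₁) * h n = 0 := by
  set d := a f₁ * b f₂ - a f₂ * b f₁ with hd
  -- Cramer's rule: `φ` and `ψ` are `d` times the coordinates dual to `a` and `b`.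
  let φ : VField k R →ₗ[R] R := b f₂ • evalAt f₁ - b f₁ • evalAt f₂
  let ψ : VField k R →ₗ[R] R := a f₁ • evalAt f₂ - a f₂ • evalAt f₁
  have h1 : φ a = d := by simp [φ, evalAt_apply, hd]; ring
  have h2 : φ b = 0 := by simp [φ, evalAt_apply]; ring
  have h3 : ψ a = 0 := by simp [ψ, evalAt_apply]; ring
  have h4 : ψ b = d := by simp [ψ, evalAt_apply, hd]
  induction hm : N - n using Nat.strong_induction_on generalizing n with
  | _ m ih =>
    have ih' : ∀ j, n < j → j < N → d * h j = 0 := fun j h1 h2 =>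
      ih (N - j) (by omega) h2 rfl
    have e1 : ∑ i ∈ Finset.range N, d * (h i * detect φ ψ (n + 2) (curvIter nabla a b i)) = 0 := by
      have e := congrArg (fun u : FreeLie k R => d * detect φ ψ (n + 2) (u : TAlg k R)) hsum
      simpa [Finset.mul_sum] using e
    rw [Finset.sum_eq_single_of_mem n (Finset.mem_range.2 hn), detect_curvIter φ ψ nabla h1 h2 h3 h4]
      at e1
    · refine IsReduced.eq_zero _ ⟨n + 3, ?_⟩
      calc (d * h n) ^ (n + 3) = (d * (h n * d ^ (n + 2))) * h n ^ (n + 2) := by ring_nf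
        _ = 0 := by rw [e1, zero_mul]
    · intro j hj hjn
      rcases lt_or_gt_of_ne hjn with hlt | hgt
      · rw [detect_eq_zero φ ψ (by omega) (curvIter_mem_filt nabla a b j), mul_zero, mul_zero]
      · rw [← mul_assoc, ih' j hgt (Finset.mem_range.1 hj), zero_mul]

/-- More than `n` vectors of `Rⁿ` satisfy a linear relation modulo the annihilator of `δ`. -/
theorem exists_relation {ι : Type*} [Fintype ι] {N : ℕ} (hN : Fintype.card ι < N) {δ : R}
    (hδ : δ ≠ 0) (v : Fin N → ι → R) :
    ∃ g : Fin N → R, (∀ s, δ * ∑ i, g i * v i s = 0) ∧ ∃ i, δ * g i ≠ 0 := by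
  -- Over the nonzero ring `R ⧸ I`, with `I` the annihilator of `δ`, there is no injective linear
  -- map from a free module to one of smaller rank. A coefficient that is nonzero modulo `I` is one
  -- that `δ` does not kill.
  let I : Ideal R := LinearMap.ker (LinearMap.mulLeft R δ)
  have hI : ∀ x, x ∈ I ↔ δ * x = 0 := fun x => Iff.rfl
  have hmk : ∀ x, Ideal.Quotient.mk I x = 0 ↔ δ * x = 0 := fun x => by
    rw [Ideal.Quotient.eq_zero_iff_mem, hI]
  have : Nontrivial (R ⧸ I) := by
    refine Ideal.Quotient.nontrivial_iff.2 fun h => hδ ?_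
    simpa using (hI 1).1 (h ▸ Submodule.mem_top)
  let F : (Fin N → R ⧸ I) →ₗ[R ⧸ I] (ι → R ⧸ I) :=
    Fintype.linearCombination (R ⧸ I) (fun i s => Ideal.Quotient.mk I (v i s))
  have hF : ¬ Function.Injective F := fun h => by
    have := card_le_of_injective (R ⧸ I) F h
    rw [Fintype.card_fin] at this
    omega
  rw [← LinearMap.ker_eq_bot, Submodule.eq_bot_iff] at hF
  push Not at hF
  obtain ⟨g, hg, hg0⟩ := hF
  choose g' hg' using fun i => Ideal.Quotient.mk_surjective (g i)
  refine ⟨g', fun s => ?_, ?_⟩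
  · rw [← hmk]
    have h := congrFun (LinearMap.mem_ker.1 hg) s
    simp only [F, Fintype.linearCombination_apply, Finset.sum_apply, Pi.smul_apply, smul_eq_mul,
      Pi.zero_apply] at h
    simpa [hg'] using h
  · by_contra! h
    refine hg0 (funext fun i => ?_)
    rw [← hg', (hmk _).2 (h i), Pi.zero_apply]

/-- The kernel of `Φ` is nontrivial when the vector fields are locally generated by finitely many
of them and are locally of rank at least two. -/
theorem bot_lt_K [IsReduced R] (nabla : AffineConnection k R) {n : ℕ} {e : Fin n → VField k R}
    {f : Fin n → R} {χ : R} (hχ : ∀ X : VField k R, χ • X = ∑ i, X (f i) • e i)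
    {a b : VField k R} {f₁ f₂ : R} (h : χ * (a f₁ * b f₂ - a f₂ * b f₁) ≠ 0) :
    ⊥ < K nabla := by
  set d := a f₁ * b f₂ - a f₂ * b f₁ with hd
  set u := curvIter nabla a b with hu
  -- The pairs index the matrix entries of an operator in the frame `e` with coordinates `f`.
  obtain ⟨N, hN⟩ : ∃ N, Fintype.card (Fin n × Fin n) < N := ⟨_, Nat.lt_succ_self _⟩
  obtain ⟨g, hg, l, hl⟩ := exists_relation hN h
    (fun i s => (Phi nabla (u i) (e s.1)) (f s.2))
  set v : FreeLie k R := ∑ i, g i • u i with hv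
  have hvJ : v ∈ J nabla :=
    sum_mem fun i _ => Submodule.smul_mem _ _ (curvIter_mem_J nabla a b i)
  have hve : ∀ i j, (χ * d) * (Phi nabla v (e i)) (f j) = 0 := by
    intro i j
    have h1 := hg (i, j)
    rw [← h1, hv, ← evalAt_apply]
    simp only [map_sum, map_smul, LinearMap.sum_apply, LinearMap.smul_apply, evalAt_apply,
      smul_eq_mul]
  -- One factor `χ` expands the argument `c` in the frame, another expands the value on each `e i`,
  -- and `χ * d` is the factor up to which the relation holds.
  have hT : ∀ c, (χ * χ * (χ * d)) • Phi nabla v c = 0 := by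
    intro c
    have h1 : χ • Phi nabla v c = ∑ i, c (f i) • Phi nabla v (e i) := by
      rw [← Phi_smul_of_mem_J nabla hvJ, hχ, map_sum]
      simp only [Phi_smul_of_mem_J nabla hvJ]
    have h2 : ∀ i, χ • (χ * d) • Phi nabla v (e i) = 0 := by
      intro i
      rw [hχ]
      refine Finset.sum_eq_zero fun j _ => ?_
      rw [Derivation.smul_apply, smul_eq_mul, hve, zero_smul]
    calc (χ * χ * (χ * d)) • Phi nabla v c = χ • (χ * d) • χ • Phi nabla v c := by
          rw [smul_smul, smul_smul]; congr 1; ring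
      _ = ∑ i, c (f i) • χ • (χ * d) • Phi nabla v (e i) := by
          rw [h1, Finset.smul_sum, Finset.smul_sum]
          refine Finset.sum_congr rfl fun i _ => ?_
          rw [smul_smul, smul_smul, smul_smul, smul_smul]; congr 1; ring
      _ = 0 := Finset.sum_eq_zero fun i _ => by rw [h2, smul_zero]
  rw [bot_lt_iff_ne_bot]
  intro hK
  have hmem : (χ * χ * (χ * d)) • v ∈ K nabla := by
    rw [mem_K]
    intro c
    rw [map_smul, LinearMap.smul_apply, hT]
  rw [hK, Submodule.mem_bot] at hmem
  let G : ℕ → R := fun i => if hi : i < N then (χ * χ * (χ * d)) * g ⟨i, hi⟩ else 0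
  have hsum : ∑ i ∈ Finset.range N, G i • curvIter nabla a b i = 0 := by
    rw [← Fin.sum_univ_eq_sum_range (fun i => G i • curvIter nabla a b i), ← hmem, hv,
      Finset.smul_sum]
    refine Finset.sum_congr rfl fun i _ => ?_
    simp [G, smul_smul, hu]
  have h0 := curvIter_torsionFree nabla a b f₁ f₂ N G hsum l.2
  simp only [G, l.2, dif_pos, Fin.eta, ← hd] at h0
  -- The product in `h0` contains `χ³ d² g`; the fourth power is what supplies all of these factors.
  refine hl (IsReduced.eq_zero _ ⟨4, ?_⟩)
  calc (χ * d * g l) ^ 4 = (d * (χ * χ * (χ * d) * g l)) * (χ * d ^ 2 * g l ^ 3) := by ring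
    _ = 0 := by rw [h0, zero_mul]

/-! ### Hadamard's lemma -/

section hadamard

variable {E : Type*} [NormedAddCommGroup E] [NormedSpace ℝ E]

open MeasureTheory in
-- The integral is the value at `0` of the convolution of the indicator of `(0, 1]` with `s ↦ ρ s *
-- g (y, -s)`. The bump `ρ`, equal to `1` on `[-1, 1]`, provides the compact support needed for
-- smooth dependence on the parameter `y`.
theorem contDiff_intervalIntegral {g : E × ℝ → ℝ} (hg : ContDiff ℝ ∞ g) :
    ContDiff ℝ ∞ fun y => ∫ t in (0 : ℝ)..1, g (y, t) := by
  let ρ : ContDiffBump (0 : ℝ) := ⟨1, 2, one_pos, one_lt_two⟩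
  let h : E → ℝ → ℝ := fun y s => ρ s * g (y, -s)
  have hf : LocallyIntegrable ((Set.Ioc (0 : ℝ) 1).indicator (fun _ => (1 : ℝ))) volume :=
    ((integrable_indicator_iff measurableSet_Ioc).2
      (integrableOn_const (by simp))).locallyIntegrable
  have hh : ContDiff ℝ ∞ (fun p : E × ℝ => h p.1 p.2) :=
    (ρ.contDiff.comp contDiff_snd).mul (hg.comp (contDiff_fst.prodMk contDiff_snd.neg))
  have key := contDiffOn_convolution_right_with_param_comp (n := ⊤) (μ := volume)
    (ContinuousLinearMap.mul ℝ ℝ) (s := (Set.univ : Set E)) (v := fun _ => (0 : ℝ))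
    contDiffOn_const (g := h) (k := Metric.closedBall 0 2) isOpen_univ
    (isCompact_closedBall _ _) (fun y s _ hs => by
      have : ρ s = 0 := ρ.zero_of_le_dist (by
        rw [Metric.mem_closedBall, not_le] at hs
        exact hs.le)
      simp only [h, this, zero_mul]) hf hh.contDiffOn
  rw [contDiffOn_univ] at key
  refine (congrArg (ContDiff ℝ ∞) (funext fun y => ?_)).mpr key
  rw [intervalIntegral.integral_of_le zero_le_one, convolution_def, ← integral_indicator
    measurableSet_Ioc]
  refine integral_congr_ae (.of_forall fun t => ?_)
  by_cases ht : t ∈ Set.Ioc (0 : ℝ) 1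
  · have : ρ (-t) = 1 := ρ.one_of_mem_closedBall (by
      simp only [Metric.mem_closedBall, dist_zero_right, norm_neg, Real.norm_eq_abs]
      rw [abs_of_pos ht.1]
      exact ht.2)
    simp [ht, h, this]
  · simp [ht]

/-- `F y - F y₀` is the integral of the derivative of `F` along the segment from `y₀` to `y`;
expanding `y - y₀` in the basis gives the `G i`. -/
theorem exists_hadamard {ι : Type*} [Fintype ι] (b : Module.Basis ι ℝ E) {F : E → ℝ}
    (hF : ContDiff ℝ ∞ F) (y₀ : E) :
    ∃ G : ι → E → ℝ, (∀ i, ContDiff ℝ ∞ (G i)) ∧ (∀ i, G i y₀ = fderiv ℝ F y₀ (b i)) ∧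
      ∀ y, F y = F y₀ + ∑ i, (b.repr y i - b.repr y₀ i) * G i y := by
  have hline : ContDiff ℝ ∞ (fun p : E × ℝ => y₀ + p.2 • (p.1 - y₀)) :=
    contDiff_const.add (contDiff_snd.smul (contDiff_fst.sub contDiff_const))
  have hD : ContDiff ℝ ∞ (fun p : E × ℝ => fderiv ℝ F (y₀ + p.2 • (p.1 - y₀))) :=
    (hF.fderiv_right (m := ∞) (by simp)).comp hline
  refine ⟨fun i y => ∫ t in (0 : ℝ)..1, fderiv ℝ F (y₀ + t • (y - y₀)) (b i),
    fun i => contDiff_intervalIntegral (hD.clm_apply contDiff_const), fun i => by simp,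
    fun y => ?_⟩
  have hDy : Continuous (fun t : ℝ => fderiv ℝ F (y₀ + t • (y - y₀))) :=
    hD.continuous.comp (continuous_const.prodMk continuous_id)
  have hderiv : ∀ t : ℝ, HasDerivAt (fun t : ℝ => F (y₀ + t • (y - y₀)))
      (fderiv ℝ F (y₀ + t • (y - y₀)) (y - y₀)) t := by
    intro t
    have h1 : HasDerivAt (fun t : ℝ => y₀ + t • (y - y₀)) (y - y₀) t := by
      simpa using ((hasDerivAt_id t).smul_const (y - y₀)).const_add y₀
    exact ((hF.differentiable (by simp)) _).hasFDerivAt.comp_hasDerivAt t h1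
  have hint := intervalIntegral.integral_eq_sub_of_hasDerivAt (a := 0) (b := 1)
    (fun t _ => hderiv t) ((hDy.clm_apply continuous_const).intervalIntegrable _ _)
  simp only [one_smul, zero_smul, add_zero, add_sub_cancel] at hint
  rw [eq_comm, ← eq_sub_iff_add_eq', ← hint]
  have hsum : ∀ t : ℝ, fderiv ℝ F (y₀ + t • (y - y₀)) (y - y₀) =
      ∑ i, (b.repr y i - b.repr y₀ i) * fderiv ℝ F (y₀ + t • (y - y₀)) (b i) := by
    intro t
    generalize fderiv ℝ F (y₀ + t • (y - y₀)) = L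
    conv_lhs => rw [← b.sum_repr (y - y₀), map_sum]
    simp
  simp only [hsum]
  rw [intervalIntegral.integral_finsetSum]
  · simp
  · intro i _
    exact (continuous_const.mul (hDy.clm_apply continuous_const)).intervalIntegrable _ _

end hadamard

/-! ### Local frames -/

section manifold

variable {E : Type*} [NormedAddCommGroup E] [NormedSpace ℝ E]
  {M : Type*} [TopologicalSpace M] [ChartedSpace E M] [IsManifold 𝓘(ℝ, E) ∞ M]

open Topology

theorem contDiffOn_comp_symm (q : M) (f : C^∞⟮𝓘(ℝ, E), M; ℝ⟯) :
    ContDiffOn ℝ ∞ (f ∘ (extChartAt 𝓘(ℝ, E) q).symm) (extChartAt 𝓘(ℝ, E) q).target :=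
  contMDiffOn_iff_contDiffOn.1 (f.contMDiff.comp_contMDiffOn (contMDiffOn_extChartAt_symm q))

variable {q : M}

theorem differentiableAt_comp_symm (f : C^∞⟮𝓘(ℝ, E), M; ℝ⟯) {x : M}
    (hx : x ∈ (chartAt E q).source) :
    DifferentiableAt ℝ (f ∘ (extChartAt 𝓘(ℝ, E) q).symm) (extChartAt 𝓘(ℝ, E) q x) := by
  rw [← extChartAt_source 𝓘(ℝ, E)] at hx
  exact ((contDiffOn_comp_symm q f).contDiffAt ((isOpen_extChartAt_target q).mem_nhds
    ((extChartAt 𝓘(ℝ, E) q).map_source hx))).differentiableAt (by simp)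

/-- The derivative of `f` in the direction `v` of the chart at `q`. -/
def chartDeriv (q : M) (v : E) (f : C^∞⟮𝓘(ℝ, E), M; ℝ⟯) (x : M) : ℝ :=
  fderiv ℝ (f ∘ (extChartAt 𝓘(ℝ, E) q).symm) (extChartAt 𝓘(ℝ, E) q x) v

theorem contMDiffOn_chartDeriv (q : M) (v : E) (f : C^∞⟮𝓘(ℝ, E), M; ℝ⟯) :
    ContMDiffOn 𝓘(ℝ, E) 𝓘(ℝ, ℝ) ∞ (chartDeriv q v f) (chartAt E q).source := by
  have h : ContDiffOn ℝ ∞ (fun y => fderiv ℝ (f ∘ (extChartAt 𝓘(ℝ, E) q).symm) y v)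
      (extChartAt 𝓘(ℝ, E) q).target :=
    ((contDiffOn_comp_symm q f).fderiv_of_isOpen (isOpen_extChartAt_target q)
      (by simp)).clm_apply contDiffOn_const
  refine h.contMDiffOn.comp contMDiffOn_extChartAt fun x hx => ?_
  rw [← extChartAt_source 𝓘(ℝ, E)] at hx
  exact (extChartAt 𝓘(ℝ, E) q).map_source hx

variable [FiniteDimensional ℝ E]

/-- The cutoff gives a smooth function on all of `E`, so Hadamard's lemma applies although the chart
target need not be star-shaped. -/
theorem contDiff_bump_mul_comp_symm (ψ : SmoothBumpFunction 𝓘(ℝ, E) q)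
    (f : C^∞⟮𝓘(ℝ, E), M; ℝ⟯) :
    ContDiff ℝ ∞ fun y => ψ.toContDiffBump y * f ((extChartAt 𝓘(ℝ, E) q).symm y) := by
  rw [contDiff_iff_contDiffAt]
  intro y
  by_cases hy : y ∈ (extChartAt 𝓘(ℝ, E) q).target
  · exact ψ.toContDiffBump.contDiffAt.mul ((contDiffOn_comp_symm q f).contDiffAt
      ((isOpen_extChartAt_target q).mem_nhds hy))
  · have h : y ∉ tsupport ψ.toContDiffBump := fun h => hy (ψ.closedBall_subset (by
      rw [ψ.toContDiffBump.tsupport_eq] at h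
      simpa using h))
    refine (contDiffAt_const (c := (0 : ℝ))).congr_of_eventuallyEq ?_
    filter_upwards [notMem_tsupport_iff_eventuallyEq.1 h] with z hz
    rw [hz, Pi.zero_apply, zero_mul]

variable [T2Space M]

/-- Locality: a bump function supported where `f = g` kills `f - g`, and the Leibniz rule is
evaluated at `x`. -/
theorem derivation_congr (X : VField ℝ C^∞⟮𝓘(ℝ, E), M; ℝ⟯) {f g : C^∞⟮𝓘(ℝ, E), M; ℝ⟯} {x : M}
    (h : ∀ᶠ y in 𝓝 x, f y = g y) : X f x = X g x := by
  obtain ⟨ρ, hρ⟩ := ((SmoothBumpFunction.nhds_basis_tsupport (I := 𝓘(ℝ, E)) x).mem_iff).1 h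
  let r : C^∞⟮𝓘(ℝ, E), M; ℝ⟯ := ⟨ρ, ρ.contMDiff⟩
  have h0 : r * (f - g) = 0 := by
    ext y
    change ρ y * (f y - g y) = 0
    by_cases hy : y ∈ tsupport ρ
    · rw [sub_eq_zero.2 (hρ.2 hy), mul_zero]
    · rw [image_eq_zero_of_notMem_tsupport hy, zero_mul]
  have h1 := congrArg (fun u : C^∞⟮𝓘(ℝ, E), M; ℝ⟯ => u x) (X.leibniz r (f - g))
  rw [h0, map_zero, map_sub] at h1
  change (0 : ℝ) = ρ x * (X f x - X g x) + (f x - g x) * X r x at h1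
  rw [ρ.eq_one, h.self_of_nhds, sub_self, zero_mul, add_zero, one_mul] at h1
  exact sub_eq_zero.1 h1.symm

/-- The smooth function on `M` that equals `ψ · (G ∘ φ)` on the domain of the chart `φ`. -/
def chartFun (ψ : SmoothBumpFunction 𝓘(ℝ, E) q) {G : E → ℝ} (hG : ContDiff ℝ ∞ G) :
    C^∞⟮𝓘(ℝ, E), M; ℝ⟯ :=
  ⟨fun x => ψ x • G (extChartAt 𝓘(ℝ, E) q x),
    ψ.contMDiff_smul (hG.contMDiff.comp_contMDiffOn contMDiffOn_extChartAt)⟩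

theorem chartFun_apply (ψ : SmoothBumpFunction 𝓘(ℝ, E) q) {G : E → ℝ} (hG : ContDiff ℝ ∞ G)
    (x : M) : chartFun ψ hG x = ψ x * G (extChartAt 𝓘(ℝ, E) q x) := rfl

/-- The vector field `χ ∂ᵥ`, for the chart at `q` and a bump function `χ`. -/
def chartField (χ : SmoothBumpFunction 𝓘(ℝ, E) q) (v : E) : VField ℝ C^∞⟮𝓘(ℝ, E), M; ℝ⟯ :=
  Derivation.mk'
    { toFun := fun f => ⟨fun x => χ x • chartDeriv q v f x,
        χ.contMDiff_smul (contMDiffOn_chartDeriv q v f)⟩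
      map_add' := fun f g => by
        ext x
        change χ x * _ = χ x * _ + χ x * _
        by_cases hx : x ∈ (chartAt E q).source
        · rw [← mul_add]
          congr 1
          have h := fderiv_add (differentiableAt_comp_symm f hx) (differentiableAt_comp_symm g hx)
          exact congrArg (fun L : E →L[ℝ] ℝ => L v) h
        · rw [Function.notMem_support.1 fun h => hx (χ.support_subset_source h)]
          simp
      map_smul' := fun c f => by
        ext x
        change χ x * _ = c * (χ x * _)
        by_cases hx : x ∈ (chartAt E q).source
        · rw [mul_left_comm]
          congr 1
          have h := fderiv_const_smul (differentiableAt_comp_symm f hx) c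
          exact congrArg (fun L : E →L[ℝ] ℝ => L v) h
        · rw [Function.notMem_support.1 fun h => hx (χ.support_subset_source h)]
          simp }
    (fun f g => by
      ext x
      change χ x * _ = f x * (χ x * _) + g x * (χ x * _)
      by_cases hx : x ∈ (chartAt E q).source
      · have h := fderiv_mul (differentiableAt_comp_symm f hx) (differentiableAt_comp_symm g hx)
        have h' := congrArg (fun L : E →L[ℝ] ℝ => L v) h
        have hs : (extChartAt 𝓘(ℝ, E) q).symm (extChartAt 𝓘(ℝ, E) q x) = x :=
          (extChartAt 𝓘(ℝ, E) q).left_inv (by rwa [extChartAt_source])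
        simp only [Function.comp_apply, hs, add_apply,
          smul_apply, smul_eq_mul] at h'
        rw [mul_left_comm, mul_left_comm (g x), ← mul_add]
        congr 1
      · rw [Function.notMem_support.1 fun h => hx (χ.support_subset_source h)]
        simp)

theorem chartField_apply (χ : SmoothBumpFunction 𝓘(ℝ, E) q) (v : E) (f : C^∞⟮𝓘(ℝ, E), M; ℝ⟯)
    (x : M) : chartField χ v f x = χ x * chartDeriv q v f x := rfl

/-- Hadamard's lemma at the image of `x` writes `f` near `x` as a constant plus a sum of products of
centred coordinates with smooth functions whose values at `x` are the partial derivatives of `f`. By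
locality `X` may be applied to this expression, and at `x` the Leibniz rule leaves only the
derivatives of the coordinates. -/
theorem derivation_apply_eq_sum {ι : Type*} [Fintype ι] (b : Module.Basis ι ℝ E)
    (ψ : SmoothBumpFunction 𝓘(ℝ, E) q) (hb : ∀ i, ContDiff ℝ ∞ fun y => b.repr y i)
    (X : VField ℝ C^∞⟮𝓘(ℝ, E), M; ℝ⟯) (f : C^∞⟮𝓘(ℝ, E), M; ℝ⟯) {x : M}
    (hx : x ∈ (chartAt E q).source)
    (hd : dist (extChartAt 𝓘(ℝ, E) q x) (extChartAt 𝓘(ℝ, E) q q) < ψ.rIn) :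
    X f x = ∑ i, X (chartFun ψ (hb i)) x * chartDeriv q (b i) f x := by
  set φ := extChartAt 𝓘(ℝ, E) q with hφ
  have hxs : x ∈ φ.source := by rwa [hφ, extChartAt_source]
  set F : E → ℝ := fun y => ψ.toContDiffBump y * f (φ.symm y) with hF
  obtain ⟨G, hG, hG0, hGF⟩ := exists_hadamard b (contDiff_bump_mul_comp_symm ψ f) (φ x)
  have hone : ∀ᶠ y in 𝓝 (φ x), ψ.toContDiffBump y = 1 :=
    ψ.toContDiffBump.eventuallyEq_one_of_mem_ball hd
  have hG1 : ∀ i, G i (φ x) = chartDeriv q (b i) f x := by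
    intro i
    rw [hG0, chartDeriv]
    have : F =ᶠ[𝓝 (φ x)] f ∘ φ.symm := by
      filter_upwards [hone] with y hy
      change ψ.toContDiffBump y * _ = _
      rw [hy, one_mul]
      rfl
    rw [← this.fderiv_eq]
  let A (c : ℝ) : C^∞⟮𝓘(ℝ, E), M; ℝ⟯ := algebraMap ℝ _ c
  have hA : ∀ c y, A c y = c := fun c y => rfl
  let h : C^∞⟮𝓘(ℝ, E), M; ℝ⟯ := A (F (φ x)) +
    ∑ i, (chartFun ψ (hb i) - A (b.repr (φ x) i)) * chartFun ψ (hG i)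
  have hev : ∀ (y : M) (g : ι → C^∞⟮𝓘(ℝ, E), M; ℝ⟯), (∑ i, g i) y = ∑ i, g i y := fun y g =>
    map_sum ((Pi.evalRingHom (fun _ => ℝ) y).comp ContMDiffMap.coeFnRingHom) g Finset.univ
  have hh : ∀ y, h y = F (φ x) + ∑ i, (ψ y * b.repr (φ y) i - b.repr (φ x) i) *
      (ψ y * G i (φ y)) := by
    intro y
    change F (φ x) + (∑ i, _ : C^∞⟮𝓘(ℝ, E), M; ℝ⟯) y = _
    rw [hev]
    rfl
  have hψ : ∀ᶠ y in 𝓝 x, ψ y = 1 := ψ.eventuallyEq_one_of_dist_lt hx hd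
  have hfh : ∀ᶠ y in 𝓝 x, f y = h y := by
    have hc : Filter.Tendsto φ (𝓝 x) (𝓝 (φ x)) :=
      (continuousAt_extChartAt' (I := 𝓘(ℝ, E)) hxs).tendsto
    filter_upwards [hψ, hc.eventually hone, (isOpen_extChartAt_source q).mem_nhds hxs]
      with y h1 h2 h3
    rw [hh, h1]
    have h4 := hGF (φ y)
    rw [h2, one_mul, φ.left_inv h3] at h4
    simp only [one_mul]
    exact h4
  rw [derivation_congr X hfh]
  have hXh : X h = ∑ i, ((chartFun ψ (hb i) - A (b.repr (φ x) i)) • X (chartFun ψ (hG i)) +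
      chartFun ψ (hG i) • X (chartFun ψ (hb i))) := by
    simp only [h, map_add, map_sum, Derivation.leibniz, map_sub, A, Derivation.map_algebraMap,
      sub_zero, zero_add]
  rw [hXh, hev]
  refine Finset.sum_congr rfl fun i _ => ?_
  change (ψ x * b.repr (φ x) i - b.repr (φ x) i) * X (chartFun ψ (hG i)) x +
    (ψ x * G i (φ x)) * X (chartFun ψ (hb i)) x = _
  rw [hψ.self_of_nhds, hG1]
  ring

theorem chartDeriv_chartFun (ψ : SmoothBumpFunction 𝓘(ℝ, E) q) {G : E → ℝ}
    (hG : ContDiff ℝ ∞ G) (v : E) :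
    chartDeriv q v (chartFun ψ hG) q = fderiv ℝ G (extChartAt 𝓘(ℝ, E) q q) v := by
  set φ := extChartAt 𝓘(ℝ, E) q with hφ
  have h : chartFun ψ hG ∘ φ.symm =ᶠ[𝓝 (φ q)] G := by
    have hc : Filter.Tendsto φ.symm (𝓝 (φ q)) (𝓝 q) := by
      have := continuousAt_extChartAt_symm (I := 𝓘(ℝ, E)) q
      rwa [ContinuousAt, extChartAt_to_inv] at this
    filter_upwards [hc.eventually ψ.eventuallyEq_one,
      (isOpen_extChartAt_target q).mem_nhds (mem_extChartAt_target (I := 𝓘(ℝ, E)) q)] with y h1 h2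
    rw [Function.comp_apply, chartFun_apply, h1, Pi.one_apply, one_mul, ← hφ, φ.right_inv h2]
  rw [chartDeriv, h.fderiv_eq]

variable (q) in
/-- Near every point the vector fields are generated by a frame, up to a bump function. -/
theorem exists_local_frame :
    ∃ (e : Fin (Module.finrank ℝ E) → VField ℝ C^∞⟮𝓘(ℝ, E), M; ℝ⟯)
      (f : Fin (Module.finrank ℝ E) → C^∞⟮𝓘(ℝ, E), M; ℝ⟯) (χ : C^∞⟮𝓘(ℝ, E), M; ℝ⟯),
      χ q = 1 ∧ (∀ i j, e i (f j) q = if i = j then 1 else 0) ∧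
      ∀ X : VField ℝ C^∞⟮𝓘(ℝ, E), M; ℝ⟯, χ • X = ∑ i, X (f i) • e i := by
  let b := Module.finBasis ℝ E
  have hb : ∀ i, ContDiff ℝ ∞ fun y => b.repr y i := fun i =>
    (LinearMap.toContinuousLinearMap (b.coord i)).contDiff
  obtain ⟨ψ⟩ : Nonempty (SmoothBumpFunction 𝓘(ℝ, E) q) := inferInstance
  -- The outer radius of `χ` is the inner radius of `ψ`, so `ψ = 1` wherever `χ ≠ 0`, and there the
  -- cut-off coordinates are true coordinates.
  let χ : SmoothBumpFunction 𝓘(ℝ, E) q :=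
    { rIn := ψ.rIn / 2
      rOut := ψ.rIn
      rIn_pos := half_pos ψ.rIn_pos
      rIn_lt_rOut := half_lt_self ψ.rIn_pos
      closedBall_subset := (Set.inter_subset_inter_left _
        (Metric.closedBall_subset_closedBall ψ.rIn_lt_rOut.le)).trans ψ.closedBall_subset }
  refine ⟨fun i => chartField χ (b i), fun i => chartFun ψ (hb i), ⟨χ, χ.contMDiff⟩, χ.eq_one,
    fun i j => ?_, fun X => ?_⟩
  · rw [chartField_apply, χ.eq_one, one_mul, chartDeriv_chartFun]
    have : fderiv ℝ (fun y => b.repr y j) (extChartAt 𝓘(ℝ, E) q q) =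
        LinearMap.toContinuousLinearMap (b.coord j) :=
      (LinearMap.toContinuousLinearMap (b.coord j)).fderiv
    rw [this]
    simp [Finsupp.single_apply]
  · ext f x
    have hsum : (∑ i, X (chartFun ψ (hb i)) • chartField χ (b i)) f x =
        ∑ i, X (chartFun ψ (hb i)) x * (χ x * chartDeriv q (b i) f x) := by
      rw [← evalAt_apply, map_sum]
      exact map_sum ((Pi.evalRingHom (fun _ => ℝ) x).comp ContMDiffMap.coeFnRingHom)
        (fun i => X (chartFun ψ (hb i)) * chartField χ (b i) f) Finset.univ
    rw [hsum]
    change χ x * X f x = _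
    by_cases hx : χ x = 0
    · simp [hx]
    · have hx' : x ∈ Function.support χ := hx
      rw [χ.support_eq_inter_preimage] at hx'
      rw [derivation_apply_eq_sum b ψ hb X f hx'.1 hx'.2, Finset.mul_sum]
      exact Finset.sum_congr rfl fun i _ => mul_left_comm _ _ _

end manifold

/-! ### Curvature and minors -/

section curvature

variable (nabla : AffineConnection k R)

theorem lie_smul_left (f : R) (a b : VField k R) : ⁅f • a, b⁆ = f • ⁅a, b⁆ - b f • a := by
  ext g
  simp only [Derivation.commutator_apply, Derivation.smul_apply, Derivation.sub_apply,
    Derivation.leibniz, smul_eq_mul]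
  ring

theorem curvature_antisymm (a b c : VField k R) :
    curvature nabla b a c = -curvature nabla a b c := by
  rw [curvature, curvature, ← lie_skew a b, map_neg, LinearMap.neg_apply]
  abel

theorem curvature_smul_left (f : R) (a b c : VField k R) :
    curvature nabla (f • a) b c = f • curvature nabla a b c := by
  simp only [curvature, lie_smul_left, map_smul, map_sub, LinearMap.smul_apply,
    LinearMap.sub_apply, nabla.leibniz, smul_sub]
  abel

theorem curvature_add_left (a a' b c : VField k R) :
    curvature nabla (a + a') b c = curvature nabla a b c + curvature nabla a' b c := by
  simp only [curvature, add_lie, map_add, LinearMap.add_apply]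
  abel

theorem curvature_smul_right (f : R) (a b c : VField k R) :
    curvature nabla a (f • b) c = f • curvature nabla a b c := by
  rw [curvature_antisymm, curvature_smul_left, curvature_antisymm nabla a b, smul_neg, neg_neg]

theorem curvature_add_right (a b b' c : VField k R) :
    curvature nabla a (b + b') c = curvature nabla a b c + curvature nabla a b' c := by
  rw [curvature_antisymm, curvature_add_left, curvature_antisymm nabla a b,
    curvature_antisymm nabla a b', neg_add, neg_neg, neg_neg]

/-- The curvature as a bilinear map. -/
def curvatureMap (c : VField k R) : VField k R →ₗ[R] VField k R →ₗ[R] VField k R :=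
  LinearMap.mk₂ R (fun a b => curvature nabla a b c)
    (fun a a' b => curvature_add_left nabla a a' b c)
    (fun f a b => curvature_smul_left nabla f a b c)
    (fun a b b' => curvature_add_right nabla a b b' c)
    (fun f a b => curvature_smul_right nabla f a b c)

theorem curvatureMap_apply (a b c : VField k R) :
    curvatureMap nabla c a b = curvature nabla a b c := rfl

/-- The curvature vanishes, up to a factor, on vector fields all of whose minors vanish. -/
theorem smul_curvature_eq_zero {n : ℕ} {e : Fin n → VField k R} {f : Fin n → R} {χ : R}
    (hχ : ∀ X : VField k R, χ • X = ∑ i, X (f i) • e i) {a b : VField k R}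
    (h : ∀ i j, χ * (a (f i) * b (f j) - a (f j) * b (f i)) = 0) (c : VField k R) :
    (2 * χ ^ 3) • curvature nabla a b c = 0 := by
  have h1 : ∀ a b : VField k R, (χ * χ) • curvature nabla a b c =
      ∑ i, ∑ j, (a (f i) * b (f j)) • curvature nabla (e i) (e j) c := by
    intro a b
    rw [mul_smul, ← curvature_smul_right, ← curvature_smul_left, hχ, hχ, ← curvatureMap_apply]
    simp only [map_sum, map_smul, LinearMap.sum_apply, LinearMap.smul_apply, smul_smul,
      Finset.smul_sum, curvatureMap_apply]
    rw [Finset.sum_comm]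
    simp only [mul_comm]
  -- Antisymmetrising in `a` and `b` turns the products of coefficients into minors, at the cost of
  -- the factor `2`; the third `χ` is the one in hypothesis `h`.
  have h2 : (2 * χ ^ 3) • curvature nabla a b c =
      χ • ((χ * χ) • curvature nabla a b c - (χ * χ) • curvature nabla b a c) := by
    rw [curvature_antisymm nabla a b, smul_neg, sub_neg_eq_add, ← two_smul R, smul_smul, smul_smul]
    congr 1
    ring
  rw [h2, h1, h1, ← Finset.sum_sub_distrib, Finset.smul_sum]
  refine Finset.sum_eq_zero fun i _ => ?_
  rw [← Finset.sum_sub_distrib, Finset.smul_sum]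
  refine Finset.sum_eq_zero fun j _ => ?_
  rw [← sub_smul, smul_smul, mul_comm (b (f i)), h, zero_smul]

theorem K_lt_J [IsReduced R] {a b c : VField k R} (h : curvature nabla a b c ≠ 0) :
    K nabla < J nabla := by
  refine lt_of_le_of_ne (K_le_J nabla) fun hKJ => h ?_
  have hs := curvElt_mem_J nabla a b
  rw [← hKJ, mem_K] at hs
  rw [← Phi_curvElt, hs]

end curvature

/-! ### Nontriviality of the kernel on a manifold -/

section manifold

variable {E : Type*} [NormedAddCommGroup E] [NormedSpace ℝ E]
  {M : Type*} [TopologicalSpace M] [ChartedSpace E M]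

instance isReduced_contMDiffMap : IsReduced C^∞⟮𝓘(ℝ, E), M; ℝ⟯ where
  eq_zero f hf := by
    obtain ⟨n, hn⟩ := hf
    ext x
    have h := congrArg (fun g : C^∞⟮𝓘(ℝ, E), M; ℝ⟯ => g x) hn
    have h' : f x ^ n = 0 :=
      (map_pow ((Pi.evalRingHom (fun _ => ℝ) x).comp ContMDiffMap.coeFnRingHom) f n).symm.trans h
    exact eq_zero_of_pow_eq_zero h'

variable [FiniteDimensional ℝ E] [T2Space M] [IsManifold 𝓘(ℝ, E) ∞ M]
  (nabla : AffineConnection ℝ C^∞⟮𝓘(ℝ, E), M; ℝ⟯)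

theorem bot_lt_K_of_two_le_finrank [hM : Nonempty M] (hE : 2 ≤ Module.finrank ℝ E) :
    ⊥ < K nabla := by
  obtain ⟨q⟩ := hM
  obtain ⟨e, f, χ, hq, hef, hχ⟩ := exists_local_frame (E := E) q
  let i : Fin (Module.finrank ℝ E) := ⟨0, by omega⟩
  let j : Fin (Module.finrank ℝ E) := ⟨1, by omega⟩
  -- The minor of two frame fields on their own coordinates equals `1` at `q`.
  refine bot_lt_K nabla hχ (a := e i) (b := e j) (f₁ := f i) (f₂ := f j) fun h => ?_
  have h1 := congrArg (fun g : C^∞⟮𝓘(ℝ, E), M; ℝ⟯ => g q) h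
  change χ q * (e i (f i) q * e j (f j) q - e i (f j) q * e j (f i) q) = 0 at h1
  simp [hq, hef, i, j] at h1

/-- If `K` were zero, all minors of `a` and `b` times the cutoff would vanish by `bot_lt_K`, hence
so would the curvature at every point. No separate argument on the dimension is needed. -/
theorem bot_lt_K_of_curvature_ne_zero {a b c : VField ℝ C^∞⟮𝓘(ℝ, E), M; ℝ⟯}
    (h : curvature nabla a b c ≠ 0) : ⊥ < K nabla := by
  by_contra hK
  refine h (Derivation.ext fun g => ContMDiffMap.ext fun q => ?_)
  obtain ⟨e, f, χ, hq, -, hχ⟩ := exists_local_frame (E := E) q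
  have h1 := smul_curvature_eq_zero nabla hχ (a := a) (b := b)
    (fun i j => by_contra fun h => hK (bot_lt_K nabla hχ h)) c
  have h2 := congrArg (fun X : VField ℝ C^∞⟮𝓘(ℝ, E), M; ℝ⟯ => X g q) h1
  have h3 : (χ ^ 3) q = 1 := by
    have := map_pow ((Pi.evalRingHom (fun _ => ℝ) q).comp ContMDiffMap.coeFnRingHom) χ 3
    exact this.trans (by change χ q ^ 3 = 1; rw [hq, one_pow])
  change (2 : C^∞⟮𝓘(ℝ, E), M; ℝ⟯) q * (χ ^ 3) q * (curvature nabla a b c g q) = 0 at h2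
  have h4 : (2 : C^∞⟮𝓘(ℝ, E), M; ℝ⟯) q = 2 :=
    map_ofNat ((Pi.evalRingHom (fun _ => ℝ) q).comp ContMDiffMap.coeFnRingHom) 2
  rw [h3, h4] at h2
  change curvature nabla a b c g q = 0
  linarith

end manifold

end PostLie

end

theorem mainTheorem11
    {E : Type*} [NormedAddCommGroup E] [NormedSpace ℝ E] [FiniteDimensional ℝ E]
    {M : Type*} [TopologicalSpace M] [T2Space M] [SigmaCompactSpace M]
    [ChartedSpace E M] [IsManifold 𝓘(ℝ, E) ∞ M]
    (nabla : PostLie.AffineConnection ℝ C^∞⟮𝓘(ℝ, E), M; ℝ⟯) :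
    -- the restriction of `Φ` to `J` is `C^∞(M)`-linear-operator valued
    (∀ u ∈ PostLie.J nabla, ∀ (f : C^∞⟮𝓘(ℝ, E), M; ℝ⟯) (a : PostLie.VField ℝ C^∞⟮𝓘(ℝ, E), M; ℝ⟯),
      PostLie.Phi nabla u (f • a) = f • PostLie.Phi nabla u a) ∧
    PostLie.IsGLIdeal nabla (PostLie.K nabla) ∧
    PostLie.K nabla ≤ PostLie.J nabla ∧
    -- `K ≠ 0` in dimension at least two
    (Nonempty M → 2 ≤ Module.finrank ℝ E → ⊥ < PostLie.K nabla) ∧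
    -- both inclusions are strict if the connection is not flat
    ((∃ a b c, PostLie.curvature nabla a b c ≠ 0) →
      ⊥ < PostLie.K nabla ∧ PostLie.K nabla < PostLie.J nabla) ∧
    -- the two forms of the element of `K` given by the differential Bianchi identity
    (∀ a b c : PostLie.VField ℝ C^∞⟮𝓘(ℝ, E), M; ℝ⟯,
      PostLie.glBracket nabla (PostLie.inc a) (PostLie.curvElt nabla b c) +
      PostLie.glBracket nabla (PostLie.inc b) (PostLie.curvElt nabla c a) +
      PostLie.glBracket nabla (PostLie.inc c) (PostLie.curvElt nabla a b) -
      PostLie.curvElt nabla a (PostLie.torsion nabla b c) -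
      PostLie.curvElt nabla b (PostLie.torsion nabla c a) -
      PostLie.curvElt nabla c (PostLie.torsion nabla a b) +
      PostLie.curvElt nabla a (nabla.cov b c - nabla.cov c b) +
      PostLie.curvElt nabla b (nabla.cov c a - nabla.cov a c) +
      PostLie.curvElt nabla c (nabla.cov a b - nabla.cov b a) ∈ PostLie.K nabla ∧
      PostLie.glBracket nabla (PostLie.inc a) (PostLie.curvElt nabla b c) +
      PostLie.glBracket nabla (PostLie.inc b) (PostLie.curvElt nabla c a) +
      PostLie.glBracket nabla (PostLie.inc c) (PostLie.curvElt nabla a b) +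
      PostLie.curvElt nabla a ⁅b, c⁆ +
      PostLie.curvElt nabla b ⁅c, a⁆ +
      PostLie.curvElt nabla c ⁅a, b⁆ ∈ PostLie.K nabla) :=
  ⟨fun _ hu f a => PostLie.Phi_smul_of_mem_J nabla hu f a, PostLie.isGLIdeal_K nabla,
    PostLie.K_le_J nabla, fun _ hE => PostLie.bot_lt_K_of_two_le_finrank nabla hE,
    fun ⟨_, _, _, h⟩ => ⟨PostLie.bot_lt_K_of_curvature_ne_zero nabla h, PostLie.K_lt_J nabla h⟩,
    fun a b c => ⟨PostLie.bianchi_torsion_mem_K nabla a b c, PostLie.bianchi_mem_K nabla a b c⟩⟩
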